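/- Let $N\ge 2$ and $a,b>0$ be real numbers. Let $V_{N,a}$ be the set of continuous functions $g:\mathbb{R}\to\mathbb{R}$ with $\operatorname{supp} g=[-\frac N2,\frac N2]$ that are even, strictly increasing on $[-\frac N2,0]$, and such that, with $\Delta_a^2g(x)=g(x)-2g(x-a)+g(x-2a)$: if $a<\frac N3$, then $\Delta_a^2g(x)\ge 0$ for $x\in[-\frac N2,-\frac N4+\frac{3a}4]$; if $a\ge\frac N3$, then $\Delta_a^2g(x)\ge0$ for $x\in[-\frac N2,0]\cup\{-\frac N4+\frac{3a}4\}$. For an integer $m\ge 3$ let $$T_m=\Big\{(a,b)\in(0,\infty)^2:\ \tfrac{N(m-2)}{2m-3}<a<\tfrac N2,\ \ \tfrac{2(m-1)}{N+(2m-3)a}<b\le\tfrac{2m}{N+(2m-1)a},\ \ b<\tfrac2N\Big\}.$$ For $u\in L^2(\mathbb{R})$ let $\mathcal G(u,a,b)=\{u_{\ell,k}\}_{\ell,k\in\mathbb{Z}}$ with $u_{\ell,k}(x)=e^{2\pi i\ell bx}u(x-ka)$. It is a frame for $L^2(\mathbb{R})$ if there are $A,B>0$ with $A\|f\|_2^2\le\sum_{\ell,k}|\langle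 f,u_{\ell,k}\rangle|^2\le B\|f\|_2^2$ for all $f\in L^2(\mathbb{R})$. A function $h\in L^2(\mathbb{R})$ is a dual window of $g$ if $f=\sum_{\ell,k}\langle f,h_{\ell,k}\rangle g_{\ell,k}=\sum_{\ell,k}\langle f,g_{\ell,k}\rangle h_{\ell,k}$, with unconditional convergence in $L^2(\mathbb{R})$, for every $f\in L^2(\mathbb{R})$. Theorem. Let $m\ge3$, $(a,b)\in T_m$ and $g\in V_{N,a}$. Then $\mathcal G(g,a,b)$ is a frame for $L^2(\mathbb{R})$, and there is exactly one dual window $h\in L^2(\mathbb{R})$ of $g$ with $\operatorname{supp}h\subseteq[-\frac{2m-1}2a,\frac{2m-1}2a]$. This $h$ is (essentially) bounded, and $\mathcal G(h,a,b)$ is a frame for $L^2(\mathbb{R})$ as well. -/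

import Mathlib

open MeasureTheory

/-- The Hilbert space `L²(ℝ)` of complex-valued functions, for Lebesgue measure. -/
abbrev L2R : Type := Lp ℂ 2 (volume : Measure ℝ)

/-- The pointwise time-frequency shift `M_{ω} T_{t} g`, that is
`x ↦ exp(2 π i ω x) g(x - t)`. -/
noncomputable def timeFreqShift (t ω : ℝ) (g : ℝ → ℂ) : ℝ → ℂ :=
  fun x => Complex.exp (2 * Real.pi * Complex.I * ω * x) * g (x - t)

theorem memLp_timeFreqShift (t ω : ℝ) {g : ℝ → ℂ} (hg : MemLp g 2 volume) :
    MemLp (timeFreqShift t ω g) 2 volume := by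
  have h1 : MemLp (fun x => g (x - t)) 2 volume :=
    hg.comp_measurePreserving (measurePreserving_sub_right volume t)
  have hc : Continuous fun x : ℝ => Complex.exp (2 * Real.pi * Complex.I * ω * x) := by
    fun_prop
  refine h1.of_le (hc.aestronglyMeasurable.mul h1.1) (Filter.Eventually.of_forall fun x => ?_)
  have h2 : ‖Complex.exp (2 * Real.pi * Complex.I * ω * x)‖ = 1 := by
    have h3 : (2 * Real.pi * Complex.I * ω * x : ℂ) = ((2 * Real.pi * ω * x : ℝ) : ℂ) * Complex.I := by
      push_cast
      ring
    rw [h3, Complex.norm_exp_ofReal_mul_I]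
  simp only [timeFreqShift, norm_mul, h2, one_mul, le_refl]

/-- The Gabor system `𝒢(g, a, b) = {M_{ℓ b} T_{k a} g : (ℓ, k) ∈ ℤ²}` in `L²(ℝ)`, as a family
indexed by the pairs `(ℓ, k)`. -/
noncomputable def gaborSystem (g : L2R) (a b : ℝ) : ℤ × ℤ → L2R :=
  fun p => (memLp_timeFreqShift (p.2 * a) (p.1 * b) (Lp.memLp g)).toLp
    (timeFreqShift (p.2 * a) (p.1 * b) g)

/-- A family `(e i)` in a Hilbert space is a frame: for some constants `A, B > 0`,
`A ‖f‖² ≤ ∑ |⟨f, e i⟩|² ≤ B ‖f‖²` for all `f` (with the series convergent). -/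
def IsHilbertFrame {ι H : Type*} [NormedAddCommGroup H] [InnerProductSpace ℂ H]
    (e : ι → H) : Prop :=
  ∃ A B : ℝ, 0 < A ∧ 0 < B ∧ ∀ f : H,
    Summable (fun i => ‖inner ℂ (e i) f‖ ^ 2) ∧
    A * ‖f‖ ^ 2 ≤ ∑' i, ‖inner ℂ (e i) f‖ ^ 2 ∧
    ∑' i, ‖inner ℂ (e i) f‖ ^ 2 ≤ B * ‖f‖ ^ 2

/-- `𝒢(g, a, b)` is a (Gabor) frame for `L²(ℝ)`. -/
def IsGaborFrame (g : L2R) (a b : ℝ) : Prop := IsHilbertFrame (gaborSystem g a b)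

/-- `h` is a dual window of `g`: every `f ∈ L²(ℝ)` has the two (unconditionally convergent)
expansions `f = ∑ ⟨f, M_{ℓb} T_{ka} h⟩ M_{ℓb} T_{ka} g = ∑ ⟨f, M_{ℓb} T_{ka} g⟩ M_{ℓb} T_{ka} h`.
Mathlib's inner product is conjugate-linear in its first argument. -/
def IsDualWindow (g h : L2R) (a b : ℝ) : Prop :=
  ∀ f : L2R,
    HasSum (fun p => inner ℂ (gaborSystem h a b p) f • gaborSystem g a b p) f ∧
    HasSum (fun p => inner ℂ (gaborSystem g a b p) f • gaborSystem h a b p) f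

/-- The element `h` of `L²(ℝ)` is supported in `S`: it vanishes a.e. outside of `S`. -/
def IsSupportedIn (h : L2R) (S : Set ℝ) : Prop := ∀ᵐ x : ℝ, x ∉ S → h x = 0

/-- The element `h` of `L²(ℝ)` is (essentially) bounded. -/
def IsEssBounded (h : L2R) : Prop := ∃ C : ℝ, ∀ᵐ x : ℝ, ‖h x‖ ≤ C

/-- The second difference `Δ²_a g(x) = g(x) - 2 g(x - a) + g(x - 2a)`. -/
def secondDiff (a : ℝ) (g : ℝ → ℝ) (x : ℝ) : ℝ := g x - 2 * g (x - a) + g (x - 2 * a)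

/-- The class `V_{N,a}` of generalized B-splines: continuous real-valued functions with support
`[-N/2, N/2]` that are even, strictly increasing on `[-N/2, 0]`, and satisfy the second-difference
condition (A3). -/
structure IsGeneralizedBSpline (N a : ℝ) (g : ℝ → ℝ) : Prop where
  continuous : Continuous g
  tsupport_eq : tsupport g = Set.Icc (-(N / 2)) (N / 2)
  symmetric : ∀ x, g (-x) = g x
  strictMonoOn : StrictMonoOn g (Set.Icc (-(N / 2)) 0)
  secondDiff_nonneg_of_lt : a < N / 3 →
    ∀ x ∈ Set.Icc (-(N / 2)) (-(N / 4) + 3 * a / 4), 0 ≤ secondDiff a g x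
  secondDiff_nonneg_of_le : N / 3 ≤ a →
    ∀ x ∈ Set.Icc (-(N / 2)) 0 ∪ {-(N / 4) + 3 * a / 4}, 0 ≤ secondDiff a g x

theorem IsGeneralizedBSpline.memLp {N a : ℝ} {g : ℝ → ℝ} (hg : IsGeneralizedBSpline N a g) :
    MemLp (fun x => (g x : ℂ)) 2 (volume : Measure ℝ) := by
  have hs : HasCompactSupport g := by
    rw [HasCompactSupport, hg.tsupport_eq]
    exact isCompact_Icc
  exact (hg.continuous.memLp_of_hasCompactSupport hs).ofReal

/-- A generalized B-spline as an element of `L²(ℝ)`. -/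
noncomputable def IsGeneralizedBSpline.toL2 {N a : ℝ} {g : ℝ → ℝ}
    (hg : IsGeneralizedBSpline N a g) : L2R :=
  hg.memLp.toLp (fun x => (g x : ℂ))

/-- The parameter region `T_m` (for `m ≥ 2`): the pairs `(a, b)` of positive reals with
`a ∈ (N(m-2)/(2m-3), N/2)`, `b ∈ (2(m-1)/(N+(2m-3)a), 2m/(N+(2m-1)a)]` and `b < 2/N`. -/
def gaborRegion (N : ℝ) (m : ℕ) : Set (ℝ × ℝ) :=
  {p | 0 < p.1 ∧ 0 < p.2 ∧
    p.1 ∈ Set.Ioo (N * ((m : ℝ) - 2) / (2 * (m : ℝ) - 3)) (N / 2) ∧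
    p.2 ∈ Set.Ioc (2 * ((m : ℝ) - 1) / (N + (2 * (m : ℝ) - 3) * p.1))
      (2 * (m : ℝ) / (N + (2 * (m : ℝ) - 1) * p.1)) ∧
    p.2 < 2 / N}

/-!
The frame property and the duality of windows are reduced to finite linear systems, which are then
shown to be uniquely solvable.

For bounded windows `g`, `h` of bounded support, `h` is dual to `g` if and only if
`∑ k, conj (h (x - k a)) g (x + n / b - k a) = b δ_{n, 0}` for all integers `n` and almost all `x`.
Both directions come from one computation (`hasSum_conj_gaborCoeff_mul`): when `f` and `f'` live on
intervals of length `1 / b` at distance `n / b`, Parseval's identity on such an interval evaluates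
`∑ ⟨f, h_p⟩ ⟨g_p, f'⟩` as an integral of `f`, `f'` against the sum above. Functions supported in
these intervals are total in `L²(ℝ)`, and Bessel bounds extend the reconstruction formula to all `f`
(`isGaborFrame_of_duality`); the lower frame bounds then follow from boundedness of synthesis.
Conversely, testing with indicator functions shows that the difference of two dual windows satisfies
the homogeneous conditions (`ae_tsum_conj_mul_eq_zero`).

With `T = 1 / b` and `h` supported in `[-(2m-1)a/2, (2m-1)a/2]`, the conditions are nontrivial only
for `|n| < m`, and at a point `|x| ≤ a / 2` they involve the `2m - 1` values `h (x + j a)`, `|j| < m`.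
The matrix is `g (x + j a - n T)`. The bounds on `a` and `b` give `N / 2 < T`, so that column `j` has
a positive entry `g (x - j (T - a))` on the diagonal and at most one other nonzero entry: below the
diagonal if `x - j (T - a) ≥ 0`, and above it otherwise. Elimination from both ends leaves one
`2 × 2` block, with determinant `g y g z - g (y + a) g (z + a)` for some `y, z ≥ 0`. It is positive
because `g` decreases strictly on `[0, N / 2]` (`eq_zero_of_three_term_of_support`). Hence the matrix
is invertible for `|x| ≤ a / 2`; by continuity and compactness the inverse is bounded there, and its
column `n = 0` provides the bounded dual window (`dualWindow`).
-/

/-! ### Bessel families and dual families in a Hilbert space -/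

section HilbertSpace

variable {ι H : Type*} [NormedAddCommGroup H] [InnerProductSpace ℂ H]

/-- A family `(e i)` in a Hilbert space is Bessel if the upper frame inequality
`∑ |⟨f, e i⟩|² ≤ B ‖f‖²` holds. It is phrased with finite partial sums, so that summability is
part of the condition. -/
def IsBesselFamily (e : ι → H) : Prop :=
  ∃ B : ℝ, ∀ (f : H) (s : Finset ι), ∑ i ∈ s, ‖inner ℂ (e i) f‖ ^ 2 ≤ B * ‖f‖ ^ 2

theorem IsBesselFamily.exists_analysisOperator {e : ι → H} (he : IsBesselFamily e) :
    ∃ T : H →L[ℂ] lp (fun _ : ι => ℂ) 2, ∀ f i, T f i = inner ℂ (e i) f := by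
  obtain ⟨B, hB⟩ := he
  have hmem : ∀ f, Memℓp (fun i => inner ℂ (e i) f : ι → ℂ) 2 := fun f =>
    memℓp_gen' (C := B * ‖f‖ ^ 2) fun s => by simpa using hB f s
  let L : H →ₗ[ℂ] lp (fun _ : ι => ℂ) 2 :=
    { toFun := fun f => ⟨fun i => inner ℂ (e i) f, hmem f⟩
      map_add' := fun f f' => by
        ext i
        exact inner_add_right _ _ _
      map_smul' := fun c f => by
        ext i
        exact inner_smul_right _ _ _ }
  refine ⟨L.mkContinuous (Real.sqrt |B|) fun f => ?_, fun f i => rfl⟩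
  refine lp.norm_le_of_forall_sum_le (by norm_num) (by positivity) fun s => ?_
  have h := hB f s
  have h2 : B * ‖f‖ ^ 2 ≤ (Real.sqrt |B| * ‖f‖) ^ 2 := by
    rw [mul_pow, Real.sq_sqrt (abs_nonneg B)]
    gcongr
    exact le_abs_self B
  simpa [L] using h.trans h2

theorem hasSum_smul_of_analysisOperator [CompleteSpace H] {e : ι → H}
    {T : H →L[ℂ] lp (fun _ : ι => ℂ) 2} (hT : ∀ f i, T f i = inner ℂ (e i) f)
    (c : lp (fun _ : ι => ℂ) 2) :
    HasSum (fun i => c i • e i) (T.adjoint c) := by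
  classical
  have h := (lp.hasSum_single (by norm_num) c).mapL T.adjoint
  refine h.congr_fun fun i => ?_
  refine ext_inner_right ℂ fun f => ?_
  rw [ContinuousLinearMap.adjoint_inner_left, lp.inner_single_left, hT, inner_smul_left]
  simp [mul_comm]

/-- A Bessel family with a Bessel dual family satisfies the lower frame inequality, because the
reconstruction `f = S† (T f)` is bounded in terms of the coefficients `T f`. -/
theorem isHilbertFrame_of_adjoint_comp_eq [CompleteSpace H] [Nontrivial H] {e : ι → H}
    {T S : H →L[ℂ] lp (fun _ : ι => ℂ) 2} (hT : ∀ f i, T f i = inner ℂ (e i) f)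
    (hST : ∀ f, S.adjoint (T f) = f) : IsHilbertFrame e := by
  have hnorm : ∀ f, HasSum (fun i => ‖inner ℂ (e i) f‖ ^ 2) (‖T f‖ ^ 2) := fun f => by
    have h := lp.hasSum_norm (p := 2) (by norm_num) (T f)
    simpa [hT] using h
  have hS : 0 < ‖S‖ := by
    obtain ⟨f, hf⟩ := exists_ne (0 : H)
    refine norm_pos_iff.2 fun h => hf ?_
    have := hST f
    rw [h] at this
    simpa using this.symm
  have hTn : 0 < ‖T‖ := by
    obtain ⟨f, hf⟩ := exists_ne (0 : H)
    refine norm_pos_iff.2 fun h => hf ?_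
    have := hST f
    rw [h] at this
    simpa using this.symm
  refine ⟨(‖S‖ ^ 2)⁻¹, ‖T‖ ^ 2, by positivity, by positivity, fun f => ⟨(hnorm f).summable, ?_, ?_⟩⟩
  · rw [(hnorm f).tsum_eq, inv_mul_le_iff₀ (by positivity), ← mul_pow]
    gcongr
    calc ‖f‖ = ‖S.adjoint (T f)‖ := by rw [hST]
      _ ≤ ‖S.adjoint‖ * ‖T f‖ := S.adjoint.le_opNorm _
      _ = ‖S‖ * ‖T f‖ := by rw [LinearIsometryEquiv.norm_map]
  · rw [(hnorm f).tsum_eq, ← mul_pow]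
    gcongr
    exact T.le_opNorm f

/-- Two Bessel families are dual frames as soon as the weak reconstruction formula
`∑ ⟨f, e' i⟩ ⟨e i, f'⟩ = ⟨f, f'⟩` holds for `f` and `f'` in a total set `D`. -/
theorem isHilbertFrame_and_hasSum_of_weak_dual [CompleteSpace H] [Nontrivial H] {e e' : ι → H}
    (he : IsBesselFamily e) (he' : IsBesselFamily e') (D : Set H)
    (hD : ∀ w : H, (∀ f ∈ D, inner ℂ f w = 0) → w = 0)
    (h : ∀ f ∈ D, ∀ f' ∈ D,
      HasSum (fun i => starRingEnd ℂ (inner ℂ (e i) f') * inner ℂ (e' i) f) (inner ℂ f' f)) :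
    IsHilbertFrame e ∧ IsHilbertFrame e' ∧ ∀ f,
      HasSum (fun i => inner ℂ (e' i) f • e i) f ∧ HasSum (fun i => inner ℂ (e i) f • e' i) f := by
  obtain ⟨T, hT⟩ := he.exists_analysisOperator
  obtain ⟨S, hS⟩ := he'.exists_analysisOperator
  have hweak : ∀ f ∈ D, ∀ f' ∈ D, inner ℂ (T f') (S f) = inner ℂ f' f := fun f hf f' hf' => by
    have h1 := lp.hasSum_inner (𝕜 := ℂ) (T f') (S f)
    refine h1.unique ?_
    refine (h f hf f' hf').congr_fun fun i => ?_
    rw [hT, hS, RCLike.inner_apply, mul_comm]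
  have h1 : ∀ f ∈ D, T.adjoint (S f) = f := fun f hf => by
    rw [← sub_eq_zero]
    refine hD _ fun f' hf' => ?_
    rw [inner_sub_right, ContinuousLinearMap.adjoint_inner_right, hweak f hf f' hf', sub_self]
  have h2 : ∀ f, S.adjoint (T f) = f := fun f => by
    rw [← sub_eq_zero]
    refine hD _ fun f' hf' => ?_
    rw [inner_sub_right, ContinuousLinearMap.adjoint_inner_right,
      ← ContinuousLinearMap.adjoint_inner_left, h1 f' hf', sub_self]
  have h3 : ∀ f, T.adjoint (S f) = f := fun f => by
    refine ext_inner_left ℂ fun f' => ?_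
    rw [ContinuousLinearMap.adjoint_inner_right, ← ContinuousLinearMap.adjoint_inner_left, h2]
  refine ⟨isHilbertFrame_of_adjoint_comp_eq hT h2, isHilbertFrame_of_adjoint_comp_eq hS h3,
    fun f => ⟨?_, ?_⟩⟩
  · have := hasSum_smul_of_analysisOperator hT (S f)
    simpa only [hS, h3] using this
  · have := hasSum_smul_of_analysisOperator hS (T f)
    simpa only [hT, h2] using this

end HilbertSpace

/-! ### Parseval's identity for functions supported in a period interval -/

/-- The `ℓ`-th Fourier coefficient of `F` for the frequency step `b`, that is `F̂(ℓ b)`. For `F`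
supported in an interval of length `1 / b` these are multiples of Fourier series coefficients. -/
noncomputable def fourierSample (b : ℝ) (F : ℝ → ℂ) (l : ℤ) : ℂ :=
  ∫ x : ℝ, Complex.exp (-(2 * Real.pi * Complex.I * (l * b) * x)) * F x

theorem norm_exp_neg_two_pi_I (t x : ℝ) :
    ‖Complex.exp (-(2 * Real.pi * Complex.I * t * x))‖ = 1 := by
  have h3 : (-(2 * Real.pi * Complex.I * t * x) : ℂ)
      = ((-(2 * Real.pi * t * x) : ℝ) : ℂ) * Complex.I := by
    push_cast
    ring
  rw [h3, Complex.norm_exp_ofReal_mul_I]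

theorem integrable_exp_mul (b : ℝ) (l : ℤ) {F : ℝ → ℂ} (hF : Integrable F) :
    Integrable fun x : ℝ => Complex.exp (-(2 * Real.pi * Complex.I * (l * b) * x)) * F x := by
  refine hF.bdd_mul (c := 1) ?_ (Filter.Eventually.of_forall fun x => ?_)
  · exact Continuous.aestronglyMeasurable (by fun_prop)
  · have := norm_exp_neg_two_pi_I (l * b) x
    push_cast at this
    exact this.le

theorem hasSum_norm_sq_fourierSample {b : ℝ} (hb : 0 < b) (c : ℝ) {F : ℝ → ℂ}
    (hF : MemLp F 2 volume) (hs : ∀ x, x ∉ Set.Ioc c (c + 1 / b) → F x = 0) :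
    HasSum (fun l : ℤ => ‖fourierSample b F l‖ ^ 2) (1 / b * ∫ x, ‖F x‖ ^ 2) := by
  have hc : c < c + 1 / b := by
    have : 0 < 1 / b := by positivity
    linarith
  have h := hasSum_sq_fourierCoeffOn hc (hF.restrict _)
  have hcb : c + 1 / b - c = 1 / b := by ring
  have key : ∀ l, fourierCoeffOn hc F l = b * fourierSample b F l := fun l => by
    have hset : fourierSample b F l = ∫ x in Set.Ioc c (c + 1 / b),
        Complex.exp (-(2 * Real.pi * Complex.I * (l * b) * x)) * F x :=
      (setIntegral_eq_integral_of_forall_compl_eq_zero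
        fun x hx => by rw [hs x hx, mul_zero]).symm
    rw [fourierCoeffOn_eq_integral, intervalIntegral.integral_of_le hc.le, hset, Complex.real_smul]
    congr 1
    · rw [hcb]
      simp
    · refine integral_congr_ae (Filter.Eventually.of_forall fun x => ?_)
      simp only [fourier_coe_apply, smul_eq_mul, hcb]
      congr 2
      push_cast
      field_simp
  have h2 := h.mul_left ((1 / b) ^ 2)
  have hval : 1 / b * ∫ x, ‖F x‖ ^ 2
      = (1 / b) ^ 2 * ((c + 1 / b - c)⁻¹ • ∫ x in c..c + 1 / b, ‖F x‖ ^ 2) := by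
    rw [intervalIntegral.integral_of_le hc.le,
      setIntegral_eq_integral_of_forall_compl_eq_zero
        (fun x hx => by rw [hs x hx, norm_zero]; norm_num), hcb, smul_eq_mul]
    field_simp
  rw [hval]
  refine h2.congr_fun fun l => ?_
  rw [key, norm_mul, mul_pow, Complex.norm_real, Real.norm_eq_abs, sq_abs]
  field_simp

theorem fourierSample_add {b : ℝ} {F G : ℝ → ℂ} (hF : Integrable F) (hG : Integrable G) (l : ℤ) :
    fourierSample b (fun x => F x + G x) l = fourierSample b F l + fourierSample b G l := by
  simp only [fourierSample, mul_add]
  exact integral_add (integrable_exp_mul b l hF) (integrable_exp_mul b l hG)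

theorem fourierSample_const_mul {b : ℝ} (z : ℂ) (F : ℝ → ℂ) (l : ℤ) :
    fourierSample b (fun x => z * F x) l = z * fourierSample b F l := by
  simp only [fourierSample, mul_left_comm _ z]
  exact integral_const_mul _ _

/-- A square-integrable function supported in a bounded interval is integrable. -/
theorem integrable_of_memLp_of_support {c d : ℝ} {F : ℝ → ℂ}
    (hF : MemLp F 2 volume) (hs : ∀ x, x ∉ Set.Ioc c d → F x = 0) : Integrable F := by
  have h1 : IntegrableOn F (Set.Ioc c d) := (hF.restrict _).integrable (by norm_num)
  have h2 := h1.integrable_indicator measurableSet_Ioc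
  refine h2.congr (Filter.Eventually.of_forall fun x => ?_)
  by_cases hx : x ∈ Set.Ioc c d
  · simp [hx]
  · simp [hx, hs x hx]

theorem hasSum_conj_fourierSample_mul {b : ℝ} (hb : 0 < b) (c : ℝ) {F G : ℝ → ℂ}
    (hF : MemLp F 2 volume) (hG : MemLp G 2 volume)
    (hFs : ∀ x, x ∉ Set.Ioc c (c + 1 / b) → F x = 0)
    (hGs : ∀ x, x ∉ Set.Ioc c (c + 1 / b) → G x = 0) :
    HasSum (fun l : ℤ => starRingEnd ℂ (fourierSample b F l) * fourierSample b G l)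
      ((1 / b : ℝ) * ∫ x, starRingEnd ℂ (F x) * G x) := by
  -- Polarization of the identity for the squared norms.
  have pol : ∀ z w : ℂ, starRingEnd ℂ z * w = (1 / 4 : ℂ) * (((‖z + w‖ ^ 2 : ℝ) : ℂ)
      - ((‖z + (-1) * w‖ ^ 2 : ℝ) : ℂ) - Complex.I * ((‖z + Complex.I * w‖ ^ 2 : ℝ) : ℂ)
      + Complex.I * ((‖z + (-Complex.I) * w‖ ^ 2 : ℝ) : ℂ)) := fun z w => by
    simp only [← Complex.normSq_eq_norm_sq, Complex.normSq_apply]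
    apply Complex.ext <;> simp <;> ring
  have hint : ∀ z : ℂ, MemLp (fun x => F x + z * G x) 2 volume := fun z =>
    hF.add (hG.const_mul z)
  have hFi := integrable_of_memLp_of_support hF hFs
  have hGi := integrable_of_memLp_of_support hG hGs
  have hz : ∀ z : ℂ, HasSum
      (fun l : ℤ => ((‖fourierSample b F l + z * fourierSample b G l‖ ^ 2 : ℝ) : ℂ))
      ((1 / b : ℝ) * ∫ x, ((‖F x + z * G x‖ ^ 2 : ℝ) : ℂ)) := fun z => by
    have h := hasSum_norm_sq_fourierSample hb c (hint z)
      (fun x hx => by rw [hFs x hx, hGs x hx, mul_zero, add_zero])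
    have h' := Complex.hasSum_ofReal.2 h
    rw [Complex.ofReal_mul, ← integral_complex_ofReal] at h'
    refine h'.congr_fun fun l => ?_
    rw [fourierSample_add hFi (hGi.const_mul z), fourierSample_const_mul]
  have hi : ∀ z : ℂ, Integrable fun x => ((‖F x + z * G x‖ ^ 2 : ℝ) : ℂ) := fun z =>
    ((hint z).integrable_norm_pow (by norm_num)).ofReal
  have h1 := hz 1
  have h2 := hi 1
  simp only [one_mul] at h1 h2
  have htot := (((h1.sub (hz (-1))).sub ((hz Complex.I).mul_left Complex.I)).add
    ((hz (-Complex.I)).mul_left Complex.I)).mul_left (1 / 4 : ℂ)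
  have hval : ∫ x, starRingEnd ℂ (F x) * G x = (1 / 4 : ℂ) * (
      (∫ x, ((‖F x + G x‖ ^ 2 : ℝ) : ℂ)) - (∫ x, ((‖F x + (-1) * G x‖ ^ 2 : ℝ) : ℂ))
      - Complex.I * (∫ x, ((‖F x + Complex.I * G x‖ ^ 2 : ℝ) : ℂ))
      + Complex.I * (∫ x, ((‖F x + (-Complex.I) * G x‖ ^ 2 : ℝ) : ℂ))) := by
    simp only [pol]
    rw [integral_const_mul, integral_add, integral_sub, integral_sub, integral_const_mul,
      integral_const_mul]
    · exact h2
    · exact hi _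
    · exact h2.sub (hi _)
    · exact (hi _).const_mul _
    · exact (h2.sub (hi _)).sub ((hi _).const_mul _)
    · exact (hi _).const_mul _
  have htot' := htot.congr_fun fun l => pol (fourierSample b F l) (fourierSample b G l)
  rw [htot'.summable.hasSum_iff, htot'.tsum_eq, hval]
  ring

/-! ### Gabor systems: coefficients and Bessel bounds -/

/-- The coefficient `⟨f, M_{ℓb} T_{ka} u⟩`, for functions `u`, `f` and `p = (ℓ, k)`, as a sampled
Fourier transform of `x ↦ conj (u (x - k a)) f x`. -/
noncomputable def gaborCoeff (a b : ℝ) (u f : ℝ → ℂ) (p : ℤ × ℤ) : ℂ :=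
  fourierSample b (fun x => starRingEnd ℂ (u (x - p.2 * a)) * f x) p.1

theorem inner_gaborSystem {g f : L2R} {u φ : ℝ → ℂ} (hu : g =ᵐ[volume] u) (hφ : f =ᵐ[volume] φ)
    (a b : ℝ) (p : ℤ × ℤ) : inner ℂ (gaborSystem g a b p) f = gaborCoeff a b u φ p := by
  rw [L2.inner_def, gaborCoeff, fourierSample]
  refine integral_congr_ae ?_
  have h1 := MemLp.coeFn_toLp (memLp_timeFreqShift (p.2 * a) (p.1 * b) (Lp.memLp g))
  have h2 : ∀ᵐ x : ℝ, g (x - p.2 * a) = u (x - p.2 * a) :=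
    (measurePreserving_sub_right volume (p.2 * a)).quasiMeasurePreserving.ae hu
  filter_upwards [h1, h2, hφ] with x hx1 hx2 hx3
  rw [gaborSystem, hx1, hx3, timeFreqShift, hx2, RCLike.inner_apply, map_mul, ← Complex.exp_conj]
  have : starRingEnd ℂ (2 * Real.pi * Complex.I * ((p.1 * b : ℝ) : ℂ) * x)
      = -(2 * Real.pi * Complex.I * (p.1 * b) * x) := by
    simp [map_ofNat]
  rw [this]
  ring

theorem measurePreserving_sub (t : ℝ) : MeasurePreserving (fun x : ℝ => x - t) :=
  measurePreserving_sub_right volume t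

theorem memLp_conj_mul_of_bounded {u f : ℝ → ℂ} {C : ℝ} (hu : Measurable u)
    (hC : ∀ x, ‖u x‖ ≤ C) (hf : MemLp f 2 volume) (t : ℝ) :
    MemLp (fun x => starRingEnd ℂ (u (x - t)) * f x) 2 volume := by
  refine hf.of_le_mul (c := C) ?_ (Filter.Eventually.of_forall fun x => ?_)
  · refine AEStronglyMeasurable.mul ?_ hf.1
    exact (Complex.continuous_conj.measurable.comp
      (hu.comp (measurable_id.sub_const t))).aestronglyMeasurable
  · rw [norm_mul, RCLike.norm_conj]
    exact mul_le_mul_of_nonneg_right (hC _) (norm_nonneg _)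

theorem card_filter_sub_mul_mem_Ioc_le {a : ℝ} (ha : 0 < a) (S : Finset ℤ) (x c : ℝ) {T : ℝ}
    (hT : 0 ≤ T) :
    ((S.filter fun k : ℤ => x - k * a ∈ Set.Ioc c (c + T)).card : ℝ) ≤ T / a + 1 := by
  have hsub : (S.filter fun k : ℤ => x - k * a ∈ Set.Ioc c (c + T))
      ⊆ Finset.Ico ⌈(x - c - T) / a⌉ ⌈(x - c) / a⌉ := by
    intro k hk
    obtain ⟨-, h1, h2⟩ := Finset.mem_filter.1 hk
    rw [Finset.mem_Ico]
    constructor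
    · rw [Int.ceil_le, div_le_iff₀ ha]
      linarith
    · rw [Int.lt_ceil, lt_div_iff₀ ha]
      linarith
  have hle : ⌈(x - c - T) / a⌉ ≤ ⌈(x - c) / a⌉ := 
    Int.ceil_le_ceil (div_le_div_of_nonneg_right (by linarith) ha.le)
  calc ((S.filter fun k : ℤ => x - k * a ∈ Set.Ioc c (c + T)).card : ℝ)
      ≤ ((Finset.Ico ⌈(x - c - T) / a⌉ ⌈(x - c) / a⌉).card : ℝ) := by
        exact_mod_cast Finset.card_le_card hsub
    _ = (⌈(x - c) / a⌉ : ℝ) - ⌈(x - c - T) / a⌉ := by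
        rw [Int.card_Ico]
        have : (((⌈(x - c) / a⌉ - ⌈(x - c - T) / a⌉).toNat : ℤ) : ℝ)
            = ((⌈(x - c) / a⌉ - ⌈(x - c - T) / a⌉ : ℤ) : ℝ) := by
          rw [Int.toNat_of_nonneg (by linarith)]
        push_cast at this
        exact_mod_cast this
    _ ≤ T / a + 1 := by
        have h1 := Int.ceil_lt_add_one ((x - c) / a)
        have h2 := Int.le_ceil ((x - c - T) / a)
        have h3 : (x - c) / a - (x - c - T) / a = T / a := by ring
        linarith

/-- The Bessel bound for the Gabor system of a function `u`, in terms of `gaborCoeff`. -/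
def IsBesselWindow (a b : ℝ) (u : ℝ → ℂ) : Prop :=
  ∃ B : ℝ, ∀ f : ℝ → ℂ, MemLp f 2 volume → ∀ s : Finset (ℤ × ℤ),
    ∑ p ∈ s, ‖gaborCoeff a b u f p‖ ^ 2 ≤ B * ∫ x, ‖f x‖ ^ 2

/-- For a window supported in one period of the modulations, Parseval's identity turns the
coefficients with a fixed translation into an integral, and boundedly many translates overlap. -/
theorem isBesselWindow_of_support_period {a b : ℝ} (ha : 0 < a) (hb : 0 < b) {u : ℝ → ℂ} {C : ℝ}
    (hu : Measurable u) (hC : ∀ x, ‖u x‖ ≤ C) (c : ℝ)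
    (hs : ∀ x, x ∉ Set.Ioc c (c + 1 / b) → u x = 0) : IsBesselWindow a b u := by
  classical
  refine ⟨1 / b * (C ^ 2 * (1 / b / a + 1)), fun f hf s => ?_⟩
  have hT : 0 < 1 / b := by positivity
  have hC0 : 0 ≤ C := (norm_nonneg _).trans (hC 0)
  have hmem : ∀ k : ℤ, MemLp (fun x => starRingEnd ℂ (u (x - k * a)) * f x) 2 volume :=
    fun k => memLp_conj_mul_of_bounded hu hC hf _
  have hint : ∀ k : ℤ, Integrable fun x => ‖starRingEnd ℂ (u (x - k * a)) * f x‖ ^ 2 :=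
    fun k => (hmem k).integrable_norm_pow (by norm_num)
  have hsum : ∀ k : ℤ, HasSum (fun l : ℤ => ‖gaborCoeff a b u f (l, k)‖ ^ 2)
      (1 / b * ∫ x, ‖starRingEnd ℂ (u (x - k * a)) * f x‖ ^ 2) := fun k => by
    have hsk : ∀ x, x ∉ Set.Ioc (c + k * a) (c + k * a + 1 / b) →
        starRingEnd ℂ (u (x - k * a)) * f x = 0 := fun x hx => by
      have hx' : x - k * a ∉ Set.Ioc c (c + 1 / b) := by
        rintro ⟨h1, h2⟩
        exact hx ⟨by linarith, by linarith⟩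
      rw [hs _ hx', map_zero, zero_mul]
    have h := hasSum_norm_sq_fourierSample hb (c + k * a) (hmem k) hsk
    simpa only [gaborCoeff] using h
  have hpt : ∀ x, ∑ k ∈ s.image Prod.snd, ‖starRingEnd ℂ (u (x - k * a)) * f x‖ ^ 2
      ≤ C ^ 2 * (1 / b / a + 1) * ‖f x‖ ^ 2 := fun x => by
    calc ∑ k ∈ s.image Prod.snd, ‖starRingEnd ℂ (u (x - k * a)) * f x‖ ^ 2
        ≤ ∑ k ∈ s.image Prod.snd,
            if x - k * a ∈ Set.Ioc c (c + 1 / b) then C ^ 2 * ‖f x‖ ^ 2 else 0 := by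
          refine Finset.sum_le_sum fun k _ => ?_
          split_ifs with h
          · rw [norm_mul, RCLike.norm_conj, mul_pow]
            gcongr
            exact hC _
          · rw [hs _ h, map_zero, zero_mul, norm_zero]
            norm_num
      _ = ((s.image Prod.snd).filter fun k : ℤ => x - k * a ∈ Set.Ioc c (c + 1 / b)).card
            * (C ^ 2 * ‖f x‖ ^ 2) := by
          rw [← Finset.sum_filter, Finset.sum_const, nsmul_eq_mul]
      _ ≤ (1 / b / a + 1) * (C ^ 2 * ‖f x‖ ^ 2) := by
          gcongr
          exact card_filter_sub_mul_mem_Ioc_le ha _ x c hT.le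
      _ = C ^ 2 * (1 / b / a + 1) * ‖f x‖ ^ 2 := by ring
  calc ∑ p ∈ s, ‖gaborCoeff a b u f p‖ ^ 2
      ≤ ∑ p ∈ s.image Prod.fst ×ˢ s.image Prod.snd, ‖gaborCoeff a b u f p‖ ^ 2 := by
        refine Finset.sum_le_sum_of_subset_of_nonneg (fun p hp => ?_) fun _ _ _ => by positivity
        exact Finset.mem_product.2 ⟨Finset.mem_image_of_mem _ hp, Finset.mem_image_of_mem _ hp⟩
    _ = ∑ k ∈ s.image Prod.snd, ∑ l ∈ s.image Prod.fst, ‖gaborCoeff a b u f (l, k)‖ ^ 2 :=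
        Finset.sum_product_right _ _ _
    _ ≤ ∑ k ∈ s.image Prod.snd, 1 / b * ∫ x, ‖starRingEnd ℂ (u (x - k * a)) * f x‖ ^ 2 :=
        Finset.sum_le_sum fun k _ => sum_le_hasSum _ (fun _ _ => by positivity) (hsum k)
    _ = 1 / b * ∫ x, ∑ k ∈ s.image Prod.snd, ‖starRingEnd ℂ (u (x - k * a)) * f x‖ ^ 2 := by
        rw [← Finset.mul_sum, integral_finsetSum _ fun k _ => hint k]
    _ ≤ 1 / b * ∫ x, C ^ 2 * (1 / b / a + 1) * ‖f x‖ ^ 2 := by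
        gcongr
        · exact integrable_finsetSum _ fun k _ => hint k
        · exact (hf.integrable_norm_pow (by norm_num)).const_mul _
        · exact hpt
    _ = 1 / b * (C ^ 2 * (1 / b / a + 1)) * ∫ x, ‖f x‖ ^ 2 := by
        rw [integral_const_mul]
        ring

theorem integrable_conj_mul {u f : ℝ → ℂ} (hu : MemLp u 2 volume) (hf : MemLp f 2 volume) (t : ℝ) :
    Integrable fun x => starRingEnd ℂ (u (x - t)) * f x :=
  MemLp.integrable_mul (p := 2) (q := 2) (hu.comp_measurePreserving (measurePreserving_sub t)).star
    hf

theorem IsBesselWindow.add {a b : ℝ} {u v : ℝ → ℂ} (hu : IsBesselWindow a b u)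
    (hv : IsBesselWindow a b v) (hu2 : MemLp u 2 volume) (hv2 : MemLp v 2 volume) :
    IsBesselWindow a b (u + v) := by
  obtain ⟨B, hB⟩ := hu
  obtain ⟨B', hB'⟩ := hv
  refine ⟨2 * B + 2 * B', fun f hf s => ?_⟩
  have hadd : ∀ p, gaborCoeff a b (u + v) f p = gaborCoeff a b u f p + gaborCoeff a b v f p :=
    fun p => by
      rw [gaborCoeff, gaborCoeff, gaborCoeff, ← fourierSample_add (integrable_conj_mul hu2 hf _)
        (integrable_conj_mul hv2 hf _)]
      simp only [Pi.add_apply, map_add, add_mul]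
  calc ∑ p ∈ s, ‖gaborCoeff a b (u + v) f p‖ ^ 2
      ≤ ∑ p ∈ s, (2 * ‖gaborCoeff a b u f p‖ ^ 2 + 2 * ‖gaborCoeff a b v f p‖ ^ 2) := by
        refine Finset.sum_le_sum fun p _ => ?_
        rw [hadd]
        have h := norm_add_le (gaborCoeff a b u f p) (gaborCoeff a b v f p)
        have h' := pow_le_pow_left₀ (norm_nonneg _) h 2
        nlinarith [sq_nonneg (‖gaborCoeff a b u f p‖ - ‖gaborCoeff a b v f p‖)]
    _ = 2 * ∑ p ∈ s, ‖gaborCoeff a b u f p‖ ^ 2 + 2 * ∑ p ∈ s, ‖gaborCoeff a b v f p‖ ^ 2 := by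
        rw [Finset.sum_add_distrib, Finset.mul_sum, Finset.mul_sum]
    _ ≤ (2 * B + 2 * B') * ∫ x, ‖f x‖ ^ 2 := by
        have h1 := hB f hf s
        have h2 := hB' f hf s
        linarith

theorem memLp_of_bounded_of_support {u : ℝ → ℂ} {C c d : ℝ} (hu : Measurable u)
    (hC : ∀ x, ‖u x‖ ≤ C) (hs : ∀ x, x ∉ Set.Ioc c d → u x = 0) : MemLp u 2 volume := by
  have h1 : MemLp ((Set.Ioc c d).indicator fun _ => (C : ℂ)) 2 volume :=
    memLp_indicator_const 2 measurableSet_Ioc _ (Or.inr (by simp))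
  refine h1.of_le hu.aestronglyMeasurable (Filter.Eventually.of_forall fun x => ?_)
  by_cases hx : x ∈ Set.Ioc c d
  · have : 0 ≤ C := (norm_nonneg _).trans (hC 0)
    simpa [hx, abs_of_nonneg this] using hC x
  · simp [hx, hs x hx]

theorem isBesselWindow_of_bounded_of_support {a b : ℝ} (ha : 0 < a) (hb : 0 < b) {C : ℝ} (c : ℝ)
    (n : ℕ) : ∀ {u : ℝ → ℂ}, Measurable u → (∀ x, ‖u x‖ ≤ C) →
      (∀ x, x ∉ Set.Ioc c (c + n / b) → u x = 0) → IsBesselWindow a b u := by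
  have hind : ∀ {u : ℝ → ℂ} (S : Set ℝ), (∀ x, ‖u x‖ ≤ C) → ∀ x, ‖S.indicator u x‖ ≤ C :=
    fun S hC x => (norm_indicator_le_norm_self _ _).trans (hC x)
  have hsupp : ∀ {u : ℝ → ℂ} (S : Set ℝ), ∀ x, x ∉ S → S.indicator u x = 0 :=
    fun S x hx => Set.indicator_of_notMem hx _
  induction n with
  | zero =>
    intro u hu hC hs
    have h0 : ∀ x, u x = 0 := fun x => hs x (by simp)
    refine ⟨0, fun f _ s => ?_⟩
    simp [gaborCoeff, fourierSample, h0]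
  | succ n ih =>
    intro u hu hC hs
    set S := Set.Ioc c (c + n / b) with hS
    set S' := Set.Ioc (c + n / b) (c + n / b + 1 / b) with hS'
    have hsplit : S.indicator u + S'.indicator u = u := by
      funext x
      by_cases h1 : x ∈ S
      · have h2 : x ∉ S' := fun h2 => by linarith [h1.2, h2.1]
        simp [h1, h2]
      · by_cases h2 : x ∈ S'
        · simp [h1, h2]
        · have h0 : u x = 0 := by
            refine hs x fun hx => ?_
            rcases le_or_gt x (c + n / b) with h | h
            · exact h1 ⟨hx.1, h⟩
            · refine h2 ⟨h, ?_⟩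
              have := hx.2
              push_cast at this
              rw [add_div] at this
              linarith
          simp [h1, h2, h0]
    have hm : Measurable (S.indicator u) := hu.indicator measurableSet_Ioc
    have hm' : Measurable (S'.indicator u) := hu.indicator measurableSet_Ioc
    rw [← hsplit]
    exact (ih hm (hind S hC) (hsupp S)).add
      (isBesselWindow_of_support_period ha hb hm' (hind S' hC) _ (hsupp S'))
      (memLp_of_bounded_of_support hm (hind S hC) (hsupp S))
      (memLp_of_bounded_of_support hm' (hind S' hC) (hsupp S'))

theorem norm_sq_eq_integral {f : L2R} {φ : ℝ → ℂ} (hφ : f =ᵐ[volume] φ) :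
    ‖f‖ ^ 2 = ∫ x, ‖φ x‖ ^ 2 := by
  have h := inner_self_eq_norm_sq_to_K (𝕜 := ℂ) f
  rw [L2.inner_def] at h
  have h2 : ∫ x, inner ℂ (f x) (f x) = ((∫ x, ‖φ x‖ ^ 2 : ℝ) : ℂ) := by
    rw [← integral_complex_ofReal]
    refine integral_congr_ae ?_
    filter_upwards [hφ] with x hx
    rw [hx, inner_self_eq_norm_sq_to_K]
    push_cast
    rfl
  rw [h2] at h
  apply Complex.ofReal_injective
  rw [Complex.ofReal_pow]
  exact h.symm

theorem isBesselFamily_gaborSystem {a b R C : ℝ} (ha : 0 < a) (hb : 0 < b) {g : L2R} {u : ℝ → ℂ}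
    (hgu : g =ᵐ[volume] u) (hu : Measurable u) (hC : ∀ x, ‖u x‖ ≤ C)
    (hs : ∀ x, R ≤ |x| → u x = 0) : IsBesselFamily (gaborSystem g a b) := by
  obtain ⟨n, hn⟩ := exists_nat_ge (2 * R * b)
  obtain ⟨B, hB⟩ := isBesselWindow_of_bounded_of_support ha hb (-R) n hu hC fun x hx => by
    refine hs x ?_
    by_contra! h
    rw [abs_lt] at h
    refine hx ⟨h.1, ?_⟩
    have : 2 * R ≤ n / b := by rwa [le_div_iff₀ hb]
    linarith
  refine ⟨B, fun f s => ?_⟩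
  have h := hB f (Lp.memLp f) s
  rw [norm_sq_eq_integral (Filter.EventuallyEq.refl _ _)]
  simpa only [inner_gaborSystem hgu (Filter.EventuallyEq.refl _ (f : ℝ → ℂ))] using h

/-! ### The duality conditions -/

theorem fourierSample_comp_add {b : ℝ} (hb : 0 < b) (n : ℤ) (G : ℝ → ℂ) (l : ℤ) :
    fourierSample b (fun x => G (x + n / b)) l = fourierSample b G l := by
  rw [fourierSample, fourierSample,
    ← integral_add_right_eq_self (fun x : ℝ =>
      Complex.exp (-(2 * Real.pi * Complex.I * (l * b) * x)) * G x) ((n : ℝ) / b)]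
  refine integral_congr_ae (Filter.Eventually.of_forall fun x => ?_)
  have hb' : (b : ℂ) ≠ 0 := by exact_mod_cast hb.ne'
  have : (-(2 * Real.pi * Complex.I * (l * b) * ((x + n / b : ℝ) : ℂ)) : ℂ)
      = -(2 * Real.pi * Complex.I * (l * b) * x)
        + ((-(l * n) : ℤ) : ℂ) * (2 * Real.pi * Complex.I) := by
    push_cast
    field_simp
    ring
  simp only
  rw [this, Complex.exp_add, Complex.exp_int_mul_two_pi_mul_I, mul_one]

/-- For `f` and `f'` supported in period intervals at distance `n / b`, the sum
`∑ ⟨f, h_p⟩ ⟨g_p, f'⟩` over the Gabor systems of `g` and `h` is an integral against the function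
`∑ k, conj (h (x - k a)) g (x + n / b - k a)` of the duality conditions. The set `F` collects the
translations under which `h` meets the interval. -/
theorem hasSum_conj_gaborCoeff_mul {a b : ℝ} (hb : 0 < b) (c : ℝ) (n : ℤ) {g h f f' : ℝ → ℂ}
    (hf : ∀ x, x ∉ Set.Ioc c (c + 1 / b) → f x = 0)
    (hf' : ∀ x, x ∉ Set.Ioc c (c + 1 / b) → f' (x + n / b) = 0)
    (hL : ∀ k : ℤ, MemLp (fun x => starRingEnd ℂ (h (x - k * a)) * f x) 2 volume)
    (hL' : ∀ k : ℤ, MemLp (fun x => starRingEnd ℂ (g (x - k * a)) * f' x) 2 volume)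
    (F : Finset ℤ) (hF : ∀ k, k ∉ F → ∀ x ∈ Set.Ioc c (c + 1 / b), h (x - k * a) = 0) :
    HasSum (fun p => starRingEnd ℂ (gaborCoeff a b g f' p) * gaborCoeff a b h f p)
      ((1 / b : ℝ) * ∫ x, (∑ k ∈ F, starRingEnd ℂ (h (x - k * a)) * g (x + n / b - k * a))
        * (f x * starRingEnd ℂ (f' (x + n / b)))) := by
  classical
  set t : ℤ × ℤ → ℂ := fun p => starRingEnd ℂ (gaborCoeff a b g f' p) * gaborCoeff a b h f p
    with ht
  have hLs : ∀ k : ℤ, MemLp (fun x => starRingEnd ℂ (g (x + n / b - k * a)) * f' (x + n / b))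
      2 volume := fun k =>
    (hL' k).comp_measurePreserving (measurePreserving_add_right volume ((n : ℝ) / b))
  have hk : ∀ k : ℤ, HasSum (fun l : ℤ => t (l, k)) ((1 / b : ℝ) * ∫ x,
      starRingEnd ℂ (starRingEnd ℂ (g (x + n / b - k * a)) * f' (x + n / b))
        * (starRingEnd ℂ (h (x - k * a)) * f x)) := fun k => by
    have h1 := hasSum_conj_fourierSample_mul hb c (hLs k) (hL k)
      (fun x hx => by rw [hf' x hx, mul_zero]) (fun x hx => by rw [hf x hx, mul_zero])
    refine h1.congr_fun fun l => ?_
    simp only [ht, gaborCoeff]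
    rw [← fourierSample_comp_add hb n (fun x => starRingEnd ℂ (g (x - k * a)) * f' x)]
  have hzero : ∀ p : ℤ × ℤ, p.2 ∉ F → t p = 0 := fun p hp => by
    have : (fun x => starRingEnd ℂ (h (x - p.2 * a)) * f x) = fun _ => 0 := by
      funext x
      by_cases hx : x ∈ Set.Ioc c (c + 1 / b)
      · rw [hF _ hp x hx, map_zero, zero_mul]
      · rw [hf x hx, mul_zero]
    simp only [ht]
    rw [gaborCoeff, gaborCoeff, this]
    simp [fourierSample]
  have hk' : ∀ k ∈ F, HasSum (fun p : ℤ × ℤ => if p.2 = k then t p else 0) ((1 / b : ℝ) * ∫ x,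
      starRingEnd ℂ (starRingEnd ℂ (g (x + n / b - k * a)) * f' (x + n / b))
        * (starRingEnd ℂ (h (x - k * a)) * f x)) := fun k _ => by
    have hinj : Function.Injective fun l : ℤ => ((l, k) : ℤ × ℤ) := fun l l' h => by
      simpa using h
    refine (hinj.hasSum_iff ?_).1 ?_
    · rintro ⟨l, k'⟩ hp
      rw [if_neg]
      rintro rfl
      exact hp ⟨l, rfl⟩
    · refine (hk k).congr_fun fun l => ?_
      simp
  have hsum := hasSum_sum hk'
  have hint : ∀ k ∈ F, Integrable fun x =>
      starRingEnd ℂ (starRingEnd ℂ (g (x + n / b - k * a)) * f' (x + n / b))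
        * (starRingEnd ℂ (h (x - k * a)) * f x) := fun k _ =>
    MemLp.integrable_mul (p := 2) (q := 2) (hLs k).star (hL k)
  rw [← Finset.mul_sum, ← integral_finsetSum _ hint] at hsum
  have hval : ∀ x, ∑ k ∈ F, starRingEnd ℂ (starRingEnd ℂ (g (x + n / b - k * a)) * f' (x + n / b))
        * (starRingEnd ℂ (h (x - k * a)) * f x)
      = (∑ k ∈ F, starRingEnd ℂ (h (x - k * a)) * g (x + n / b - k * a))
        * (f x * starRingEnd ℂ (f' (x + n / b))) := fun x => by
    rw [Finset.sum_mul]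
    refine Finset.sum_congr rfl fun k _ => ?_
    rw [map_mul, Complex.conj_conj]
    ring
  simp only [hval] at hsum
  refine hsum.congr_fun fun p => ?_
  rw [Finset.sum_ite_eq]
  split_ifs with hp
  · rfl
  · exact hzero p hp

/-- Only finitely many translates of a bounded set meet a given interval. -/
theorem exists_finset_forall_notMem_le_abs {a : ℝ} (ha : 0 < a) (R c d : ℝ) :
    ∃ F : Finset ℤ, ∀ k, k ∉ F → ∀ x ∈ Set.Ioc c d, R ≤ |x - k * a| := by
  refine ⟨Finset.Icc (-⌈(|c| + |d| + R) / a⌉) ⌈(|c| + |d| + R) / a⌉, fun k hk x hx => ?_⟩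
  have hx1 : |x| ≤ |c| + |d| := by
    rw [abs_le]
    have := hx.1
    have := hx.2
    have := neg_abs_le c
    have := le_abs_self d
    have := abs_nonneg c
    have := abs_nonneg d
    constructor <;> linarith
  have hk1 : ⌈(|c| + |d| + R) / a⌉ < |k| := by
    by_contra! h
    exact hk (Finset.mem_Icc.2 (abs_le.1 h))
  have hk2 : (|c| + |d| + R) / a < |(k : ℝ)| := by
    have h1 : ((⌈(|c| + |d| + R) / a⌉ : ℤ) : ℝ) < ((|k| : ℤ) : ℝ) := by exact_mod_cast hk1
    rw [Int.cast_abs] at h1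
    exact (Int.le_ceil _).trans_lt h1
  rw [div_lt_iff₀ ha] at hk2
  have h3 : |(k : ℝ) * a| = |(k : ℝ)| * a := by rw [abs_mul, abs_of_pos ha]
  have h4 := abs_sub_abs_le_abs_sub ((k : ℝ) * a) x
  rw [abs_sub_comm]
  linarith

/-- The elements of `L²(ℝ)` supported in one of the period intervals `(i / b, (i + 1) / b]`. -/
def locallySupported (b : ℝ) : Set L2R :=
  {f | ∃ i : ℤ, ∀ᵐ x : ℝ, x ∉ Set.Ioc ((i : ℝ) / b) (i / b + 1 / b) → f x = 0}

theorem exists_mem_Ioc_div {b : ℝ} (hb : 0 < b) (x : ℝ) :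
    ∃ i : ℤ, x ∈ Set.Ioc ((i : ℝ) / b) (i / b + 1 / b) := by
  refine ⟨⌈x * b⌉ - 1, ?_, ?_⟩
  · rw [div_lt_iff₀ hb]
    have := Int.ceil_lt_add_one (x * b)
    push_cast
    linarith
  · rw [← add_div, le_div_iff₀ hb]
    have := Int.le_ceil (x * b)
    push_cast
    linarith

theorem eq_zero_of_forall_locallySupported_inner {b : ℝ} (hb : 0 < b) (w : L2R)
    (h : ∀ f ∈ locallySupported b, inner ℂ f w = 0) : w = 0 := by
  have hi : ∀ i : ℤ, ∀ᵐ x : ℝ, x ∈ Set.Ioc ((i : ℝ) / b) (i / b + 1 / b) → w x = 0 := fun i => by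
    set I := Set.Ioc ((i : ℝ) / b) (i / b + 1 / b)
    have hm : MemLp (I.indicator w) 2 volume := (Lp.memLp w).indicator measurableSet_Ioc
    have h1 := h (hm.toLp _) ⟨i, by
      filter_upwards [hm.coeFn_toLp] with x hx hxi
      rw [hx, Set.indicator_of_notMem hxi]⟩
    have h2 : ∫ x, I.indicator (fun x => ‖w x‖ ^ 2) x = 0 := by
      apply Complex.ofReal_injective
      rw [← integral_complex_ofReal, Complex.ofReal_zero, ← h1, L2.inner_def]
      refine integral_congr_ae ?_
      filter_upwards [hm.coeFn_toLp] with x hx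
      rw [hx]
      by_cases hxi : x ∈ I
      · simp only [Set.indicator_of_mem hxi]
        rw [inner_self_eq_norm_sq_to_K]
        push_cast
        rfl
      · simp [Set.indicator_of_notMem hxi]
    rw [integral_eq_zero_iff_of_nonneg] at h2
    · filter_upwards [h2] with x hx hxi
      simpa [Set.indicator_of_mem hxi] using hx
    · intro x
      exact Set.indicator_nonneg (fun x _ => by positivity) x
    · exact ((Lp.memLp w).integrable_norm_pow (by norm_num)).indicator measurableSet_Ioc
  rw [Lp.eq_zero_iff_ae_eq_zero]
  filter_upwards [ae_all_iff.2 hi] with x hx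
  obtain ⟨i, hxi⟩ := exists_mem_Ioc_div hb x
  exact hx i hxi

instance nontrivial_L2R : Nontrivial L2R := by
  refine ⟨⟨indicatorConstLp 2 (measurableSet_Ioc (a := (0 : ℝ)) (b := 1)) (by simp) 1, 0, ?_⟩⟩
  rw [← norm_ne_zero_iff, norm_indicatorConstLp (by norm_num) (by norm_num)]
  simp

/-- Sufficiency of the duality conditions: if
`∑ k, conj (h (x - k a)) g (x + n / b - k a) = b δ_{n, 0}` for all `x` and `n`, for bounded windows
`g`, `h` with bounded support, then both generate frames and `h` is a dual window of `g`. -/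
theorem isGaborFrame_of_duality {a b R C : ℝ} (ha : 0 < a) (hb : 0 < b) {G H : L2R}
    {g h : ℝ → ℂ} (hG : G =ᵐ[volume] g) (hH : H =ᵐ[volume] h)
    (hg : Measurable g) (hgC : ∀ x, ‖g x‖ ≤ C) (hgs : ∀ x, R ≤ |x| → g x = 0)
    (hh : Measurable h) (hhC : ∀ x, ‖h x‖ ≤ C) (hhs : ∀ x, R ≤ |x| → h x = 0)
    (hdual : ∀ x : ℝ, ∀ n : ℤ, ∑' k : ℤ, starRingEnd ℂ (h (x - k * a)) * g (x + n / b - k * a)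
      = if n = 0 then (b : ℂ) else 0) :
    IsGaborFrame G a b ∧ IsGaborFrame H a b ∧ IsDualWindow G H a b := by
  refine isHilbertFrame_and_hasSum_of_weak_dual (isBesselFamily_gaborSystem ha hb hG hg hgC hgs)
    (isBesselFamily_gaborSystem ha hb hH hh hhC hhs) (locallySupported b)
    (eq_zero_of_forall_locallySupported_inner hb) ?_
  rintro f ⟨i, hfi⟩ f' ⟨j, hfj⟩
  set c : ℝ := i / b
  set I := Set.Ioc c (c + 1 / b) with hI
  set J := Set.Ioc ((j : ℝ) / b) (j / b + 1 / b) with hJ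
  set φ : ℝ → ℂ := I.indicator f with hφ
  set ψ : ℝ → ℂ := J.indicator f' with hψ
  have hfφ : f =ᵐ[volume] φ := by
    filter_upwards [hfi] with x hx
    by_cases hxi : x ∈ I
    · simp [hφ, hxi]
    · simp [hφ, hxi, hx hxi]
  have hfψ : f' =ᵐ[volume] ψ := by
    filter_upwards [hfj] with x hx
    by_cases hxi : x ∈ J
    · simp [hψ, hxi]
    · simp [hψ, hxi, hx hxi]
  have hφL : MemLp φ 2 volume := (Lp.memLp f).indicator measurableSet_Ioc
  have hψL : MemLp ψ 2 volume := (Lp.memLp f').indicator measurableSet_Ioc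
  have hshift : ∀ x : ℝ, x + ((j - i : ℤ) : ℝ) / b ∈ J ↔ x ∈ I := fun x => by
    have : ((j - i : ℤ) : ℝ) / b = j / b - c := by
      push_cast
      rw [sub_div]
    rw [this, hI, hJ, Set.mem_Ioc, Set.mem_Ioc]
    constructor <;> rintro ⟨h1, h2⟩ <;> constructor <;> linarith
  obtain ⟨F, hF⟩ := exists_finset_forall_notMem_le_abs ha R c (c + 1 / b)
  have key := hasSum_conj_gaborCoeff_mul (a := a) hb c (j - i) (g := g) (h := h) (f := φ) (f' := ψ)
    (fun x hx => Set.indicator_of_notMem hx _)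
    (fun x hx => Set.indicator_of_notMem (fun h => hx ((hshift x).1 h)) _)
    (fun k => memLp_conj_mul_of_bounded hh hhC hφL _)
    (fun k => memLp_conj_mul_of_bounded hg hgC hψL _) F
    (fun k hk x hx => hhs _ (hF k hk x hx))
  simp only [inner_gaborSystem hG hfψ, inner_gaborSystem hH hfφ]
  have hval : ∀ x, (∑ k ∈ F, starRingEnd ℂ (h (x - k * a)) * g (x + ((j - i : ℤ) : ℝ) / b - k * a))
      * (φ x * starRingEnd ℂ (ψ (x + ((j - i : ℤ) : ℝ) / b)))
      = (if j - i = 0 then (b : ℂ) else 0)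
        * (φ x * starRingEnd ℂ (ψ (x + ((j - i : ℤ) : ℝ) / b))) := fun x => by
    by_cases hx : x ∈ I
    · rw [← hdual x (j - i), tsum_eq_sum (s := F)]
      intro k hk
      rw [hhs _ (hF k hk x hx), map_zero, zero_mul]
    · have : φ x = 0 := Set.indicator_of_notMem hx _
      rw [this]
      ring
  have hinner : inner ℂ f' f = ∫ x, φ x * starRingEnd ℂ (ψ x) := by
    rw [L2.inner_def]
    refine integral_congr_ae ?_
    filter_upwards [hfφ, hfψ] with x hx hx'
    rw [hx, hx', RCLike.inner_apply]
  simp only [hval, integral_const_mul] at key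
  have hb' : (b : ℂ) ≠ 0 := by exact_mod_cast hb.ne'
  rw [hinner]
  by_cases hij : j - i = 0
  · rw [if_pos hij, hij] at key
    simp only [Int.cast_zero, zero_div, add_zero] at key
    convert key using 1
    push_cast
    field_simp
  · rw [if_neg hij] at key
    have h0 : ∀ x, φ x * starRingEnd ℂ (ψ x) = 0 := fun x => by
      by_cases hx : x ∈ I
      · have hxJ : x ∉ J := fun hxJ => by
          refine hij ?_
          have h1 : (j : ℝ) < i + 1 := by
            have := hxJ.1.trans_le hx.2
            rw [← add_div] at this
            exact (div_lt_div_iff_of_pos_right hb).1 this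
          have h2 : (i : ℝ) < j + 1 := by
            have := hx.1.trans_le hxJ.2
            rw [← add_div] at this
            exact (div_lt_div_iff_of_pos_right hb).1 this
          have h1' : j < i + 1 := by exact_mod_cast h1
          have h2' : i < j + 1 := by exact_mod_cast h2
          omega
        rw [hψ, Set.indicator_of_notMem hxJ, map_zero, mul_zero]
      · rw [hφ, Set.indicator_of_notMem hx, zero_mul]
    simp only [h0, integral_zero]
    simpa using key

/-- Necessity of the duality conditions, in homogeneous form: if the Gabor systems of `g` and `d`
satisfy `∑ ⟨f, d_p⟩ ⟨g_p, f'⟩ = 0` for all `f` and `f'`, then the functions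
`∑ k, conj (d (x - k a)) g (x + n / b - k a)` vanish almost everywhere. -/
theorem ae_tsum_conj_mul_eq_zero {a b R C : ℝ} (ha : 0 < a) (hb : 0 < b) {g d : ℝ → ℂ}
    (hg : Measurable g) (hgC : ∀ x, ‖g x‖ ≤ C) (hd : MemLp d 2 volume)
    (hds : ∀ x, R ≤ |x| → d x = 0)
    (h : ∀ f f' : ℝ → ℂ, MemLp f 2 volume → MemLp f' 2 volume →
      HasSum (fun p => starRingEnd ℂ (gaborCoeff a b g f' p) * gaborCoeff a b d f p) 0) :
    ∀ᵐ x : ℝ, ∀ n : ℤ, ∑' k : ℤ, starRingEnd ℂ (d (x - k * a)) * g (x + n / b - k * a) = 0 := by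
  have hni : ∀ n i : ℤ, ∀ᵐ x : ℝ, x ∈ Set.Ioc ((i : ℝ) / b) (i / b + 1 / b) →
      ∑' k : ℤ, starRingEnd ℂ (d (x - k * a)) * g (x + n / b - k * a) = 0 := fun n i => by
    set c : ℝ := i / b
    set I := Set.Ioc c (c + 1 / b)
    obtain ⟨F, hF⟩ := exists_finset_forall_notMem_le_abs ha R c (c + 1 / b)
    set S : ℝ → ℂ := fun x => ∑ k ∈ F, starRingEnd ℂ (d (x - k * a)) * g (x + n / b - k * a)
      with hS
    have hdI : ∀ k : ℤ, MemLp (fun x => starRingEnd ℂ (d (x - k * a)) * I.indicator 1 x) 2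
        volume := fun k => by
      have h1 : MemLp (fun x => starRingEnd ℂ (d (x - k * a))) 2 volume :=
        (hd.comp_measurePreserving (measurePreserving_sub (k * a))).star
      refine (h1.indicator (measurableSet_Ioc (a := c) (b := c + 1 / b))).congr_norm
        ?_ (Filter.Eventually.of_forall fun x => ?_)
      · exact h1.1.mul ((measurable_const (a := (1 : ℂ))).indicator
          measurableSet_Ioc).aestronglyMeasurable
      · by_cases hx : x ∈ I
        · rw [Set.indicator_of_mem hx, Set.indicator_of_mem hx, Pi.one_apply, mul_one]
        · rw [Set.indicator_of_notMem hx, Set.indicator_of_notMem hx, mul_zero]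
    have hone : MemLp (I.indicator (1 : ℝ → ℂ)) 2 volume :=
      memLp_indicator_const 2 measurableSet_Ioc _ (Or.inr (by simp))
    have hSI : Integrable (I.indicator S) := by
      have h1 : Integrable fun x => ∑ k ∈ F,
          g (x + n / b - k * a) * (starRingEnd ℂ (d (x - k * a)) * I.indicator 1 x) := by
        refine integrable_finsetSum _ fun k _ => ?_
        refine (integrable_of_memLp_of_support (c := c) (d := c + 1 / b) (hdI k)
          fun x hx => ?_).bdd_mul (c := C) ?_
          (Filter.Eventually.of_forall fun x => hgC _)
        · rw [Set.indicator_of_notMem hx, mul_zero]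
        · exact (hg.comp ((measurable_id.add_const _).sub_const _)).aestronglyMeasurable
      refine h1.congr (Filter.Eventually.of_forall fun x => ?_)
      by_cases hx : x ∈ I
      · simp only [Set.indicator_of_mem hx, hS, Pi.one_apply]
        exact Finset.sum_congr rfl fun k _ => by ring
      · simp [Set.indicator_of_notMem hx]
    have hzero : ∀ s : Set ℝ, MeasurableSet s → volume s < ⊤ → ∫ x in s, I.indicator S x = 0 := by
      intro s hs _
      -- Testing with the indicator of `I` and the translate of the indicator of `s ∩ I`.
      set f' : ℝ → ℂ := fun x => (s ∩ I).indicator 1 (x - n / b) with hf'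
      have hf'L : MemLp f' 2 volume :=
        (memLp_indicator_const 2 (hs.inter measurableSet_Ioc) (1 : ℂ) (Or.inr
          ((measure_mono Set.inter_subset_right).trans_lt (by simp)).ne)).comp_measurePreserving
          (measurePreserving_sub (n / b))
      have key := hasSum_conj_gaborCoeff_mul (a := a) hb c n (g := g) (h := d)
        (f := I.indicator 1) (f' := f') (fun x hx => Set.indicator_of_notMem hx _)
        (fun x hx => by
          simp only [hf', add_sub_cancel_right]
          exact Set.indicator_of_notMem (fun h => hx h.2) _)
        hdI (fun k => memLp_conj_mul_of_bounded hg hgC hf'L _) F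
        (fun k hk x hx => hds _ (hF k hk x hx))
      have h0 := key.unique (h _ _ hone hf'L)
      have hb' : ((1 / b : ℝ) : ℂ) ≠ 0 := by
        exact_mod_cast (by positivity : (1 / b : ℝ) ≠ 0)
      have h1 := (mul_eq_zero.1 h0).resolve_left hb'
      rw [← integral_indicator hs, ← h1]
      refine integral_congr_ae (Filter.Eventually.of_forall fun x => ?_)
      simp only [hf', add_sub_cancel_right]
      by_cases hx : x ∈ I <;> by_cases hx' : x ∈ s <;>
        simp [Set.indicator, hx, hx', hS]
    have hae := hSI.ae_eq_zero_of_forall_setIntegral_eq_zero hzero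
    filter_upwards [hae] with x hx hxI
    rw [Set.indicator_of_mem hxI] at hx
    rw [tsum_eq_sum (s := F)]
    · exact hx
    · intro k hk
      rw [hds _ (hF k hk x hxI), map_zero, zero_mul]
  filter_upwards [ae_all_iff.2 fun n => ae_all_iff.2 (hni n)] with x hx n
  obtain ⟨i, hi⟩ := exists_mem_Ioc_div hb x
  exact hx n i hi

/-- Two dual windows of `g` are indistinguishable when tested against the Gabor system of `g`. -/
theorem hasSum_conj_gaborCoeff_sub_mul_eq_zero {a b : ℝ} {G H H' : L2R} {g d : ℝ → ℂ}
    (hG : G =ᵐ[volume] g) (hd : (H' - H : L2R) =ᵐ[volume] d)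
    (hH : IsDualWindow G H a b) (hH' : IsDualWindow G H' a b) {f f' : ℝ → ℂ}
    (hf : MemLp f 2 volume) (hf' : MemLp f' 2 volume) :
    HasSum (fun p => starRingEnd ℂ (gaborCoeff a b g f' p) * gaborCoeff a b d f p) 0 := by
  have h1 := ((hH (hf.toLp f)).1).mapL (innerSL ℂ (hf'.toLp f'))
  have h2 := ((hH' (hf.toLp f)).1).mapL (innerSL ℂ (hf'.toLp f'))
  have h3 := h2.sub h1
  rw [sub_self] at h3
  refine h3.congr_fun fun p => ?_
  have hlin : gaborCoeff a b d f p = gaborCoeff a b H' f p - gaborCoeff a b H f p := by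
    have hadd : gaborCoeff a b H' f p = gaborCoeff a b d f p + gaborCoeff a b H f p := by
      have hdL : MemLp d 2 volume := (memLp_congr_ae hd).1 (Lp.memLp _)
      rw [gaborCoeff, gaborCoeff, gaborCoeff, ← fourierSample_add (integrable_conj_mul hdL hf _)
        (integrable_conj_mul (Lp.memLp H) hf _), fourierSample, fourierSample]
      refine integral_congr_ae ?_
      have hae : ∀ᵐ x : ℝ, H' x = d x + H x := by
        filter_upwards [hd, Lp.coeFn_sub H' H] with x hx hx'
        rw [← hx, hx', Pi.sub_apply, sub_add_cancel]
      filter_upwards [(measurePreserving_sub (p.2 * a)).quasiMeasurePreserving.ae hae] with x hx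
      rw [hx, map_add]
      ring
    rw [hadd, add_sub_cancel_right]
  simp only [innerSL_apply_apply, inner_smul_right]
  rw [← sub_mul, ← inner_conj_symm (hf'.toLp f'), inner_gaborSystem hG hf'.coeFn_toLp,
    inner_gaborSystem (Filter.EventuallyEq.refl _ (H : ℝ → ℂ)) hf.coeFn_toLp,
    inner_gaborSystem (Filter.EventuallyEq.refl _ (H' : ℝ → ℂ)) hf.coeFn_toLp, hlin, mul_comm]

/-! ### Generalized B-splines and the matrices of the duality conditions -/

namespace IsGeneralizedBSpline

variable {N a : ℝ} {g : ℝ → ℝ}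

theorem eq_zero_of_le_abs (hg : IsGeneralizedBSpline N a g) {x : ℝ} (hx : N / 2 ≤ |x|) :
    g x = 0 := by
  have hclosed : IsClosed {y | g y = 0} := isClosed_eq hg.continuous continuous_const
  have hsub : Set.Ioi (N / 2) ⊆ {y | g y = 0} := fun y hy => by
    refine image_eq_zero_of_notMem_tsupport ?_
    rw [hg.tsupport_eq]
    exact fun h => not_lt.2 h.2 hy
  have h := hclosed.closure_subset_iff.2 hsub
  rw [closure_Ioi] at h
  have h1 : g |x| = 0 := h hx
  rcases abs_choice x with h2 | h2
  · rwa [h2] at h1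
  · rwa [h2, hg.symmetric] at h1

theorem apply_abs (hg : IsGeneralizedBSpline N a g) (x : ℝ) : g |x| = g x := by
  rcases abs_choice x with h2 | h2
  · rw [h2]
  · rw [h2, hg.symmetric]

theorem apply_add_lt (hg : IsGeneralizedBSpline N a g) {y s : ℝ} (hy : 0 ≤ y) (hy' : y < N / 2)
    (hs : 0 < s) : g (y + s) < g y := by
  have hmono : ∀ t, y < t → t ≤ N / 2 → g t < g y := fun t ht ht' => by
    rw [← hg.symmetric t, ← hg.symmetric y]
    exact hg.strictMonoOn ⟨by linarith, by linarith⟩ ⟨by linarith, by linarith⟩ (by linarith)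
  rcases le_or_gt (y + s) (N / 2) with h | h
  · exact hmono _ (by linarith) h
  · rw [hg.eq_zero_of_le_abs (h.le.trans (le_abs_self _)),
      ← hg.eq_zero_of_le_abs (x := N / 2) (le_abs_self _)]
    exact hmono _ hy' le_rfl

theorem pos_of_abs_lt (hg : IsGeneralizedBSpline N a g) {x : ℝ} (hx : |x| < N / 2) : 0 < g x := by
  rw [← hg.apply_abs, ← hg.eq_zero_of_le_abs (x := N / 2) (le_abs_self _)]
  have := hg.apply_add_lt (abs_nonneg x) hx (sub_pos.2 hx)
  rwa [add_sub_cancel] at this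

theorem nonneg (hg : IsGeneralizedBSpline N a g) (x : ℝ) : 0 ≤ g x := by
  rcases le_or_gt (N / 2) |x| with h | h
  · exact (hg.eq_zero_of_le_abs h).ge
  · exact (hg.pos_of_abs_lt h).le

theorem exists_bound (hg : IsGeneralizedBSpline N a g) : ∃ C, ∀ x, ‖(g x : ℂ)‖ ≤ C := by
  have hs : HasCompactSupport g := by
    rw [HasCompactSupport, hg.tsupport_eq]
    exact isCompact_Icc
  obtain ⟨C, hC⟩ := hs.exists_bound_of_continuous hg.continuous
  exact ⟨C, fun x => by simpa using hC x⟩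

end IsGeneralizedBSpline

section Kernel

variable {N a T : ℝ} {g : ℝ → ℝ} {m : ℕ}

theorem abs_sub_mul_lt (hc : 0 < T - a) (hmc : ((m : ℝ) - 1) * (T - a) < (N - a) / 2) {x : ℝ}
    (hx : |x| ≤ a / 2) {n : ℤ} (hn : |n| < m) : |x - n * (T - a)| < N / 2 := by
  have h1 : |(n : ℝ)| ≤ m - 1 := by
    have : |n| ≤ (m : ℤ) - 1 := by omega
    exact_mod_cast this
  calc |x - n * (T - a)| ≤ |x| + |n * (T - a)| := abs_sub _ _
    _ = |x| + |(n : ℝ)| * (T - a) := by rw [abs_mul, abs_of_pos hc]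
    _ ≤ a / 2 + (m - 1) * (T - a) := by gcongr
    _ < N / 2 := by linarith

/-- Forward elimination in the tridiagonal system: as long as the diagonal argument of the next
column is nonnegative, the superdiagonal entry vanishes, and the unknown is determined by the
previous one. -/
theorem eq_zero_of_three_term (hg : IsGeneralizedBSpline N a g) (hT : N / 2 < T) (hc : 0 < T - a)
    (hmc : ((m : ℝ) - 1) * (T - a) < (N - a) / 2) {x : ℝ} (hx : |x| ≤ a / 2) {v : ℤ → ℂ}
    (hv : ∀ j : ℤ, (m : ℤ) ≤ |j| → v j = 0)
    (h3 : ∀ n : ℤ, |n| < m → v (n - 1) * g (x - n * (T - a) - a) + v n * g (x - n * (T - a))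
      + v (n + 1) * g (x - n * (T - a) + a) = 0) (n : ℤ) (hn : 0 ≤ x - (n + 1) * (T - a)) :
    v n = 0 := by
  rcases lt_or_ge n (-m) with hlt | hge
  · exact hv n (by rw [abs_of_neg (by omega)]; omega)
  induction n, hge using Int.leInduction with
  | base => exact hv _ (by simp)
  | succ n hmn ih =>
    push_cast at hn
    have h0 : v n = 0 := ih (by linarith)
    rcases lt_or_ge |n + 1| (m : ℤ) with hm | hm
    · have h := h3 (n + 1) hm
      have h2 : v (n + 1 + 1) * g (x - ((n + 1 : ℤ) : ℝ) * (T - a) + a) = 0 := by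
        rcases lt_or_ge |n + 1 + 1| (m : ℤ) with hm' | hm'
        · rw [hg.eq_zero_of_le_abs, Complex.ofReal_zero, mul_zero]
          refine le_trans ?_ (le_abs_self _)
          push_cast
          linarith
        · rw [hv _ hm', zero_mul]
      rw [add_sub_cancel_right, h0, h2, zero_mul, zero_add, add_zero] at h
      refine (mul_eq_zero.1 h).resolve_right ?_
      exact_mod_cast (hg.pos_of_abs_lt (abs_sub_mul_lt hc hmc hx hm)).ne'
    · exact hv _ hm

/-- The tridiagonal system has only the trivial solution: elimination from both ends leaves a
`2 × 2` system with matrix `[[g y, g (y + a)], [g (z + a), g z]]`, where `y, z ≥ 0` and `g`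
decreases strictly on the positive half of its support. -/
theorem eq_zero_of_three_term_of_support (hg : IsGeneralizedBSpline N a g) (ha : 0 < a)
    (hT : N / 2 < T) (hc : 0 < T - a)
    (hmc : ((m : ℝ) - 1) * (T - a) < (N - a) / 2) {x : ℝ} (hx : |x| ≤ a / 2) {v : ℤ → ℂ}
    (hv : ∀ j : ℤ, (m : ℤ) ≤ |j| → v j = 0)
    (h3 : ∀ n : ℤ, |n| < m → v (n - 1) * g (x - n * (T - a) - a) + v n * g (x - n * (T - a))
      + v (n + 1) * g (x - n * (T - a) + a) = 0) (n : ℤ) : v n = 0 := by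
  have hlow := eq_zero_of_three_term hg hT hc hmc hx hv h3
  have hhigh : ∀ n : ℤ, x - (n - 1) * (T - a) ≤ 0 → v n = 0 := fun n hn => by
    have h := eq_zero_of_three_term hg hT hc hmc (x := -x) (v := fun j => v (-j))
      (by rwa [abs_neg]) (fun j hj => hv _ (by rwa [abs_neg])) (fun n hn => ?_) (-n) ?_
    · simpa using h
    · have h := h3 (-n) (by rwa [abs_neg])
      rw [← hg.symmetric (x - _ - a), ← hg.symmetric (x - _), ← hg.symmetric (x - _ + a)] at h
      rw [← h]
      push_cast
      ring_nf
    · push_cast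
      linarith
  set k : ℤ := ⌊x / (T - a)⌋ with hk
  have hk1 : k * (T - a) ≤ x := (le_div_iff₀ hc).1 (Int.floor_le _)
  have hk2 : x < (k + 1) * (T - a) := (div_lt_iff₀ hc).1 (Int.lt_floor_add_one _)
  have hprev : ∀ n : ℤ, n ≤ k - 1 → v n = 0 := fun n hn => by
    refine hlow n ?_
    have h1 : (n : ℝ) + 1 ≤ k := by exact_mod_cast (by omega : n + 1 ≤ k)
    have := mul_le_mul_of_nonneg_right h1 hc.le
    linarith
  have hnext : ∀ n : ℤ, k + 2 ≤ n → v n = 0 := fun n hn => by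
    refine hhigh n ?_
    have h1 : (k : ℝ) + 1 ≤ n - 1 := by exact_mod_cast (by omega : k + 1 ≤ n - 1)
    have := mul_le_mul_of_nonneg_right h1 hc.le
    linarith
  have hrow : |k| < m → v k * g (x - k * (T - a)) + v (k + 1) * g (x - k * (T - a) + a) = 0 :=
    fun hm => by
      have h := h3 k hm
      rwa [hprev (k - 1) le_rfl, zero_mul, zero_add] at h
  have hrow' : |k + 1| < m → v k * g ((k + 1) * (T - a) - x + a)
      + v (k + 1) * g ((k + 1) * (T - a) - x) = 0 := fun hm => by
    have h := h3 (k + 1) hm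
    rw [hnext (k + 1 + 1) (by omega), zero_mul, add_zero, add_sub_cancel_right,
      ← hg.symmetric (x - _ - a), ← hg.symmetric (x - _)] at h
    rw [← h]
    push_cast
    ring_nf
  have hdiag : ∀ n : ℤ, |n| < m → (g (x - n * (T - a)) : ℂ) ≠ 0 := fun n hn => by
    exact_mod_cast (hg.pos_of_abs_lt (abs_sub_mul_lt hc hmc hx hn)).ne'
  have hboth : v k = 0 ∧ v (k + 1) = 0 := by
    rcases lt_or_ge |k| (m : ℤ) with h1 | h1
    · rcases lt_or_ge |k + 1| (m : ℤ) with h2 | h2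
      · set y := x - k * (T - a) with hy
        set z := (k + 1) * (T - a) - x with hz
        have hy0 : 0 ≤ y := by linarith
        have hz0 : 0 ≤ z := by linarith
        have hyN : y < N / 2 := (le_abs_self _).trans_lt (abs_sub_mul_lt hc hmc hx h1)
        have hzN : z < N / 2 := by
          have := abs_sub_mul_lt hc hmc hx h2
          rw [abs_sub_comm] at this
          push_cast at this
          exact (le_abs_self _).trans_lt this
        have e1 := hrow h1
        have e2 := hrow' h2
        have hdet : g y * g z - g (y + a) * g (z + a) ≠ 0 := by
          have hgy := hg.apply_add_lt hy0 hyN ha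
          have hgz := hg.apply_add_lt hz0 hzN ha
          have := mul_lt_mul'' hgy hgz (hg.nonneg _) (hg.nonneg _)
          linarith
        have hdet' : (g y * g z - g (y + a) * g (z + a) : ℂ) ≠ 0 := by exact_mod_cast hdet
        have d1 : v k * (g y * g z - g (y + a) * g (z + a) : ℂ) = 0 := by
          linear_combination (g z : ℂ) * e1 - (g (y + a) : ℂ) * e2
        have d2 : v (k + 1) * (g y * g z - g (y + a) * g (z + a) : ℂ) = 0 := by
          linear_combination (g y : ℂ) * e2 - (g (z + a) : ℂ) * e1
        exact ⟨(mul_eq_zero.1 d1).resolve_right hdet', (mul_eq_zero.1 d2).resolve_right hdet'⟩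
      · have h0 := hv _ h2
        have e1 := hrow h1
        rw [h0, zero_mul, add_zero] at e1
        exact ⟨(mul_eq_zero.1 e1).resolve_right (hdiag k h1), h0⟩
    · have h0 := hv _ h1
      refine ⟨h0, ?_⟩
      rcases lt_or_ge |k + 1| (m : ℤ) with h2 | h2
      · have e2 := hrow' h2
        rw [h0, zero_mul, zero_add] at e2
        refine (mul_eq_zero.1 e2).resolve_right ?_
        have := hdiag (k + 1) h2
        rw [← hg.symmetric] at this
        push_cast at this
        rwa [neg_sub] at this
      · exact hv _ h2
  rcases lt_trichotomy n k with h | rfl | h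
  · exact hprev n (by omega)
  · exact hboth.1
  · rcases eq_or_ne n (k + 1) with rfl | h'
    · exact hboth.2
    · exact hnext n (by omega)

/-- The square system of the duality conditions for `|x| ≤ a / 2` has only the trivial solution.
Since `T > N / 2`, column `j` has nonzero entries only in the rows `j - 1`, `j` and `j + 1`. -/
theorem eq_zero_of_sum_mul_eq_zero (hg : IsGeneralizedBSpline N a g) (ha : 0 < a)
    (hT : N / 2 < T) (hc : 0 < T - a)
    (hmc : ((m : ℝ) - 1) * (T - a) < (N - a) / 2) {x : ℝ} (hx : |x| ≤ a / 2) {v : ℤ → ℂ}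
    (hv : ∀ j : ℤ, (m : ℤ) ≤ |j| → v j = 0)
    (hsum : ∀ n : ℤ, |n| < m →
      ∑ j ∈ Finset.Ioo (-m : ℤ) m, v j * g (x + j * a - n * T) = 0) (n : ℤ) : v n = 0 := by
  refine eq_zero_of_three_term_of_support hg ha hT hc hmc hx hv (fun n hn => ?_) n
  have h := hsum n hn
  have hmem : ∀ j : ℤ, j ∈ Finset.Ioo (-m : ℤ) m ↔ |j| < m := fun j => by
    rw [Finset.mem_Ioo, abs_lt]
  have hfar : ∀ j : ℤ, |j| < m → j ∉ Finset.Icc (n - 1) (n + 1) →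
      g (x + j * a - n * T) = 0 := fun j hj hjn => by
    refine hg.eq_zero_of_le_abs ?_
    have h1 := abs_lt.1 (abs_sub_mul_lt hc hmc hx hj)
    have harg : x + j * a - n * T = x - j * (T - a) + (j - n) * T := by ring
    rw [Finset.mem_Icc, not_and_or, not_le, not_le] at hjn
    have hN : 0 < T := by
      have := abs_nonneg (x - j * (T - a))
      have := abs_sub_mul_lt hc hmc hx hj
      linarith
    rw [harg]
    rcases hjn with h2 | h2
    · have h3 : (j : ℝ) - n ≤ -2 := by exact_mod_cast (by omega : j - n ≤ -2)
      have h4 := mul_le_mul_of_nonneg_right h3 hN.le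
      refine le_trans ?_ (neg_le_abs _)
      linarith
    · have h3 : (2 : ℝ) ≤ j - n := by exact_mod_cast (by omega : 2 ≤ j - n)
      have h4 := mul_le_mul_of_nonneg_right h3 hN.le
      refine le_trans ?_ (le_abs_self _)
      linarith
  have hout : ∀ j : ℤ, ¬ |j| < m → v j * g (x + j * a - n * T) = 0 := fun j hj => by
    rw [hv j (not_lt.1 hj), zero_mul]
  have h1 : ∑ j ∈ Finset.Ioo (-m : ℤ) m, v j * g (x + j * a - n * T)
      = ∑ j ∈ Finset.Icc (n - 1) (n + 1), v j * g (x + j * a - n * T) := by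
    rw [Finset.sum_subset (Finset.subset_union_left (s₂ := Finset.Icc (n - 1) (n + 1)))
      fun j _ hj => hout j (by rwa [← hmem])]
    symm
    refine Finset.sum_subset Finset.subset_union_right fun j _ hj => ?_
    by_cases hjm : |j| < m
    · rw [hfar j hjm hj, Complex.ofReal_zero, mul_zero]
    · exact hout j hjm
  have hIcc : Finset.Icc (n - 1) (n + 1) = {n - 1, n, n + 1} := by
    ext j
    simp only [Finset.mem_Icc, Finset.mem_insert, Finset.mem_singleton]
    omega
  rw [h1, hIcc, Finset.sum_insert, Finset.sum_insert, Finset.sum_singleton] at h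
  · rw [← h]
    push_cast
    ring_nf
  · simp
  · simp only [Finset.mem_insert, Finset.mem_singleton]
    omega

/-- The matrix of the duality conditions at the point `x`: the unknowns are the values of the dual
window at `x + j a`, and the row `n` belongs to the shift by `n T`, for `|j|, |n| < m`. -/
noncomputable def dualityMatrix (a T : ℝ) (g : ℝ → ℝ) (m : ℕ) (x : ℝ) :
    Matrix (Finset.Ioo (-m : ℤ) m) (Finset.Ioo (-m : ℤ) m) ℂ :=
  fun n j => g (x + (j : ℤ) * a - (n : ℤ) * T)

theorem det_dualityMatrix_ne_zero (hg : IsGeneralizedBSpline N a g) (ha : 0 < a)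
    (hT : N / 2 < T) (hc : 0 < T - a)
    (hmc : ((m : ℝ) - 1) * (T - a) < (N - a) / 2) {x : ℝ} (hx : |x| ≤ a / 2) :
    (dualityMatrix a T g m x).det ≠ 0 := by
  intro hdet
  obtain ⟨v, hv0, hv⟩ := Matrix.exists_mulVec_eq_zero_iff.2 hdet
  set v' : ℤ → ℂ := fun j => if hj : j ∈ Finset.Ioo (-m : ℤ) m then v ⟨j, hj⟩ else 0 with hv'
  have hmem : ∀ j : ℤ, j ∈ Finset.Ioo (-m : ℤ) m ↔ |j| < m := fun j => by
    rw [Finset.mem_Ioo, abs_lt]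
  have hzero := eq_zero_of_sum_mul_eq_zero hg ha hT hc hmc hx (v := v')
    (fun j hj => by
      simp only [hv']
      rw [dif_neg (by rw [hmem]; exact not_lt.2 hj)])
    (fun n hn => by
      have h := congrFun hv ⟨n, (hmem n).2 hn⟩
      rw [Matrix.mulVec, dotProduct, Pi.zero_apply] at h
      rw [← h, ← Finset.sum_coe_sort]
      refine Finset.sum_congr rfl fun j _ => ?_
      simp only [hv', dualityMatrix, Subtype.coe_eta, Finset.coe_mem, dite_true]
      rw [mul_comm])
  refine hv0 (funext fun j => ?_)
  have h := hzero j
  simp only [hv', Finset.coe_mem, Subtype.coe_eta, dite_true] at h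
  exact h

theorem continuous_dualityMatrix (hg : Continuous g) : Continuous (dualityMatrix a T g m) := by
  refine continuous_matrix fun n j => ?_
  exact Complex.continuous_ofReal.comp (hg.comp (by fun_prop))

/-- The entries of the inverse matrices are measurable in `x`, and by compactness they are bounded
for `|x| ≤ a / 2`. -/
theorem measurable_and_bounded_inv_dualityMatrix (hg : IsGeneralizedBSpline N a g) (ha : 0 < a)
    (hT : N / 2 < T) (hc : 0 < T - a) (hmc : ((m : ℝ) - 1) * (T - a) < (N - a) / 2)
    (k n : Finset.Ioo (-m : ℤ) m) :
    Measurable (fun x => (dualityMatrix a T g m x)⁻¹ k n) ∧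
      ∃ C, ∀ x, |x| ≤ a / 2 → ‖(dualityMatrix a T g m x)⁻¹ k n‖ ≤ C := by
  have hcont := continuous_dualityMatrix (a := a) (T := T) (m := m) hg.continuous
  have hdet : Continuous fun x => (dualityMatrix a T g m x).det := hcont.matrix_det
  have hadj : Continuous fun x => (dualityMatrix a T g m x).adjugate k n :=
    hcont.matrix_adjugate.matrix_elem k n
  have heq : ∀ x, (dualityMatrix a T g m x)⁻¹ k n
      = ((dualityMatrix a T g m x).det)⁻¹ * (dualityMatrix a T g m x).adjugate k n := fun x => by
    rw [Matrix.inv_def, Matrix.smul_apply, Ring.inverse_eq_inv', smul_eq_mul]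
  simp only [heq]
  refine ⟨hdet.measurable.inv.mul hadj.measurable, ?_⟩
  have hon : ContinuousOn (fun x => ((dualityMatrix a T g m x).det)⁻¹
      * (dualityMatrix a T g m x).adjugate k n) (Set.Icc (-(a / 2)) (a / 2)) :=
    (hdet.continuousOn.inv₀ fun x hx =>
      det_dualityMatrix_ne_zero hg ha hT hc hmc (abs_le.2 hx)).mul hadj.continuousOn
  obtain ⟨C, hC⟩ := isCompact_Icc.exists_bound_of_continuousOn hon
  exact ⟨C, fun x hx => hC x (abs_le.1 hx)⟩

end Kernel

/-! ### The dual window and its uniqueness -/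

section DualWindow

variable {N a T : ℝ} {g : ℝ → ℝ} {m : ℕ}

theorem exists_eq_add_int_mul {a : ℝ} (ha : 0 < a) (x : ℝ) :
    ∃ (k : ℤ) (y : ℝ), y ∈ Set.Ico (-(a / 2)) (a / 2) ∧ x = y + k * a := by
  refine ⟨⌊x / a + 1 / 2⌋, x - ⌊x / a + 1 / 2⌋ * a, ⟨?_, ?_⟩, by ring⟩
  · have h := mul_le_mul_of_nonneg_right (Int.floor_le (x / a + 1 / 2)) ha.le
    rw [add_mul, div_mul_cancel₀ _ ha.ne'] at h
    linarith
  · have h := mul_lt_mul_of_pos_right (Int.lt_floor_add_one (x / a + 1 / 2)) ha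
    rw [add_mul, div_mul_cancel₀ _ ha.ne'] at h
    linarith

theorem eq_of_mem_Ico_of_add_int_mul_mem {a y : ℝ} {j k : ℤ} (ha : 0 < a)
    (hy : y ∈ Set.Ico (-(a / 2)) (a / 2))
    (hjk : y + j * a - k * a ∈ Set.Ico (-(a / 2)) (a / 2)) : k = j := by
  have h1 : ((j : ℝ) - k) * a < 1 * a := by linarith [hy.1, hjk.2]
  have h2 : (-1) * a < ((j : ℝ) - k) * a := by linarith [hy.2, hjk.1]
  have h3 : (j : ℝ) - k < 1 := lt_of_mul_lt_mul_right h1 ha.le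
  have h4 : (-1 : ℝ) < (j : ℝ) - k := lt_of_mul_lt_mul_right h2 ha.le
  have h3' : j - k < 1 := by exact_mod_cast h3
  have h4' : -1 < j - k := by exact_mod_cast h4
  omega

/-- For a function `u` supported in `[-(2m-1)a/2, (2m-1)a/2)`, the sums of the duality conditions
at `y + k a` with `y ∈ [-a/2, a/2)` are finite sums over `|j| < m`. -/
theorem tsum_conj_mul_eq_sum {u : ℝ → ℂ} {y : ℝ}
    (hu : ∀ j : ℤ, j ∉ Finset.Ioo (-m : ℤ) m → u (y + j * a) = 0) (k : ℤ) (s : ℝ) :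
    ∑' i : ℤ, starRingEnd ℂ (u (y + k * a - i * a)) * (g (y + k * a + s - i * a) : ℂ)
      = ∑ j ∈ Finset.Ioo (-m : ℤ) m, starRingEnd ℂ (u (y + j * a)) * g (y + j * a + s) := by
  rw [← (Equiv.subLeft k).tsum_eq, ← tsum_eq_sum (f := fun j : ℤ =>
    starRingEnd ℂ (u (y + j * a)) * (g (y + j * a + s) : ℂ))
    (L := SummationFilter.unconditional ℤ)
    (fun j hj => by rw [hu j hj, map_zero, zero_mul])]
  refine tsum_congr fun j => ?_
  have h1 : y + k * a - ((k - j : ℤ) : ℝ) * a = y + j * a := by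
    push_cast
    ring
  have h2 : y + k * a + s - ((k - j : ℤ) : ℝ) * a = y + j * a + s := by
    push_cast
    ring
  rw [Equiv.subLeft_apply, h1, h2]

/-- The window whose values at `y + k a`, for `|y| ≤ a / 2` and `|k| < m`, form the (conjugated)
solution of the system of duality conditions with right-hand side `T⁻¹ δ_{n, 0}`. -/
noncomputable def dualWindow (a T : ℝ) (g : ℝ → ℝ) (m : ℕ) (n₀ : Finset.Ioo (-m : ℤ) m) (x : ℝ) :
    ℂ :=
  ∑ k : Finset.Ioo (-m : ℤ) m, (Set.Ico (-(a / 2)) (a / 2)).indicator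
    (fun y => starRingEnd ℂ ((dualityMatrix a T g m y)⁻¹ k n₀ * (T⁻¹ : ℝ))) (x - (k : ℤ) * a)

theorem dualWindow_apply_add_mul (ha : 0 < a) (n₀ : Finset.Ioo (-m : ℤ) m) {y : ℝ}
    (hy : y ∈ Set.Ico (-(a / 2)) (a / 2)) (j : Finset.Ioo (-m : ℤ) m) :
    dualWindow a T g m n₀ (y + (j : ℤ) * a)
      = starRingEnd ℂ ((dualityMatrix a T g m y)⁻¹ j n₀ * (T⁻¹ : ℝ)) := by
  rw [dualWindow, Finset.sum_eq_single j]
  · rw [add_sub_cancel_right, Set.indicator_of_mem hy]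
  · intro k _ hk
    refine Set.indicator_of_notMem (fun h => hk ?_) _
    exact Subtype.ext (eq_of_mem_Ico_of_add_int_mul_mem ha hy h)
  · simp

theorem dualWindow_eq_zero (ha : 0 < a) (n₀ : Finset.Ioo (-m : ℤ) m) {y : ℝ}
    (hy : y ∈ Set.Ico (-(a / 2)) (a / 2)) {j : ℤ} (hj : j ∉ Finset.Ioo (-m : ℤ) m) :
    dualWindow a T g m n₀ (y + j * a) = 0 := by
  refine Finset.sum_eq_zero fun k _ => Set.indicator_of_notMem (fun h => hj ?_) _
  rw [← eq_of_mem_Ico_of_add_int_mul_mem ha hy h]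
  exact k.2

theorem dualWindow_eq_zero_of_notMem_Icc (n₀ : Finset.Ioo (-m : ℤ) m) (ha : 0 < a) {x : ℝ}
    (hx : x ∉ Set.Icc (-((2 * (m : ℝ) - 1) / 2 * a)) ((2 * (m : ℝ) - 1) / 2 * a)) :
    dualWindow a T g m n₀ x = 0 := by
  refine Finset.sum_eq_zero fun k _ => Set.indicator_of_notMem (fun h => hx ?_) _
  obtain ⟨hk1, hk2⟩ := Finset.mem_Ioo.1 k.2
  have h1 : -(m : ℝ) + 1 ≤ ((k : ℤ) : ℝ) := by exact_mod_cast (by omega : -(m : ℤ) + 1 ≤ k)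
  have h2 : ((k : ℤ) : ℝ) ≤ m - 1 := by exact_mod_cast (by omega : (k : ℤ) ≤ m - 1)
  have h3 := mul_le_mul_of_nonneg_right h1 ha.le
  have h4 := mul_le_mul_of_nonneg_right h2 ha.le
  constructor
  · linarith [h.1]
  · linarith [h.2]

theorem measurable_dualWindow (hg : IsGeneralizedBSpline N a g) (ha : 0 < a)
    (hT : N / 2 < T) (hc : 0 < T - a) (hmc : ((m : ℝ) - 1) * (T - a) < (N - a) / 2)
    (n₀ : Finset.Ioo (-m : ℤ) m) : Measurable (dualWindow a T g m n₀) := by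
  refine Finset.measurable_fun_sum _ fun k _ => ?_
  refine Measurable.comp (Measurable.indicator ?_ measurableSet_Ico) (measurable_id.sub_const _)
  exact Complex.continuous_conj.measurable.comp
    ((measurable_and_bounded_inv_dualityMatrix hg ha hT hc hmc k n₀).1.mul_const _)

theorem exists_bound_dualWindow (hg : IsGeneralizedBSpline N a g) (ha : 0 < a)
    (hT : N / 2 < T) (hc : 0 < T - a) (hmc : ((m : ℝ) - 1) * (T - a) < (N - a) / 2)
    (n₀ : Finset.Ioo (-m : ℤ) m) : ∃ C, ∀ x, ‖dualWindow a T g m n₀ x‖ ≤ C := by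
  choose C hC using fun k =>
    (measurable_and_bounded_inv_dualityMatrix hg ha hT hc hmc k n₀).2
  refine ⟨∑ k, C k * ‖((T⁻¹ : ℝ) : ℂ)‖, fun x => (norm_sum_le _ _).trans ?_⟩
  refine Finset.sum_le_sum fun k _ => ?_
  have hC0 : 0 ≤ C k := (norm_nonneg _).trans (hC k 0 (by rw [abs_zero]; positivity))
  by_cases h : x - (k : ℤ) * a ∈ Set.Ico (-(a / 2)) (a / 2)
  · rw [Set.indicator_of_mem h, RCLike.norm_conj, norm_mul]
    gcongr
    exact hC k _ (abs_le.2 ⟨h.1, h.2.le⟩)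
  · rw [Set.indicator_of_notMem h, norm_zero]
    positivity

theorem tsum_conj_dualWindow_mul (hg : IsGeneralizedBSpline N a g) (ha : 0 < a)
    (hT : N / 2 < T) (hc : 0 < T - a) (hmc : ((m : ℝ) - 1) * (T - a) < (N - a) / 2)
    (hmT : N / 2 + (2 * (m : ℝ) - 1) / 2 * a ≤ m * T) (n₀ : Finset.Ioo (-m : ℤ) m)
    (hn₀ : (n₀ : ℤ) = 0) (x : ℝ) (n : ℤ) :
    ∑' i : ℤ, starRingEnd ℂ (dualWindow a T g m n₀ (x - i * a)) * (g (x + n * T - i * a) : ℂ)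
      = if n = 0 then ((T⁻¹ : ℝ) : ℂ) else 0 := by
  obtain ⟨k, y, hy, rfl⟩ := exists_eq_add_int_mul ha x
  have hy' : |y| ≤ a / 2 := abs_le.2 ⟨hy.1, hy.2.le⟩
  rw [tsum_conj_mul_eq_sum (fun j hj => dualWindow_eq_zero ha n₀ hy hj), ← Finset.sum_coe_sort]
  simp only [dualWindow_apply_add_mul ha n₀ hy, Complex.conj_conj]
  by_cases hn : -n ∈ Finset.Ioo (-m : ℤ) m
  · have hunit : IsUnit (dualityMatrix a T g m y).det :=
      (det_dualityMatrix_ne_zero hg ha hT hc hmc hy').isUnit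
    have hmul := congrFun (congrFun (Matrix.mul_nonsing_inv _ hunit) ⟨-n, hn⟩) n₀
    rw [Matrix.mul_apply, Matrix.one_apply] at hmul
    have hiff : (⟨-n, hn⟩ : Finset.Ioo (-m : ℤ) m) = n₀ ↔ n = 0 := by
      rw [Subtype.ext_iff, hn₀]
      exact neg_eq_zero
    simp only [hiff] at hmul
    calc _ = (∑ j, dualityMatrix a T g m y ⟨-n, hn⟩ j * (dualityMatrix a T g m y)⁻¹ j n₀)
          * ((T⁻¹ : ℝ) : ℂ) := by
          rw [Finset.sum_mul]
          refine Finset.sum_congr rfl fun j _ => ?_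
          have harg : y + (j : ℤ) * a - ((-n : ℤ) : ℝ) * T = y + (j : ℤ) * a + n * T := by
            push_cast
            ring
          rw [dualityMatrix, harg]
          ring
      _ = _ := by
          rw [hmul]
          split_ifs <;> simp
  · have hn0 : n ≠ 0 := by
      rintro rfl
      refine hn ?_
      rw [neg_zero, ← hn₀]
      exact n₀.2
    rw [if_neg hn0]
    refine Finset.sum_eq_zero fun j _ => ?_
    rw [hg.eq_zero_of_le_abs, Complex.ofReal_zero, mul_zero]
    obtain ⟨hj1, hj2⟩ := Finset.mem_Ioo.1 j.2
    have h1 : -(m : ℝ) + 1 ≤ ((j : ℤ) : ℝ) := by exact_mod_cast (by omega : -(m : ℤ) + 1 ≤ j)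
    have h2 : ((j : ℤ) : ℝ) ≤ m - 1 := by exact_mod_cast (by omega : (j : ℤ) ≤ m - 1)
    have h3 := mul_le_mul_of_nonneg_right h1 ha.le
    have h4 := mul_le_mul_of_nonneg_right h2 ha.le
    have hT0 : 0 < T := by linarith
    rw [Finset.mem_Ioo, not_and_or, not_lt, not_lt] at hn
    rcases hn with hn | hn
    · have h5 : (m : ℝ) ≤ n := by exact_mod_cast (by omega : (m : ℤ) ≤ n)
      have h6 := mul_le_mul_of_nonneg_right h5 hT0.le
      refine le_trans ?_ (le_abs_self _)
      linarith [hy.1]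
    · have h5 : (n : ℝ) ≤ -m := by exact_mod_cast (by omega : n ≤ -(m : ℤ))
      have h6 := mul_le_mul_of_nonneg_right h5 hT0.le
      refine le_trans ?_ (neg_le_abs _)
      linarith [hy.2]

theorem exists_measurable_bounded_window (hg : IsGeneralizedBSpline N a g) (ha : 0 < a)
    (hT : N / 2 < T) (hc : 0 < T - a) (hmc : ((m : ℝ) - 1) * (T - a) < (N - a) / 2)
    (hmT : N / 2 + (2 * (m : ℝ) - 1) / 2 * a ≤ m * T) (hm : 0 < m) :
    ∃ (w : ℝ → ℂ) (C : ℝ), Measurable w ∧ (∀ x, ‖w x‖ ≤ C) ∧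
      (∀ x, x ∉ Set.Icc (-((2 * (m : ℝ) - 1) / 2 * a)) ((2 * (m : ℝ) - 1) / 2 * a) → w x = 0) ∧
      ∀ (x : ℝ) (n : ℤ),
        ∑' i : ℤ, starRingEnd ℂ (w (x - i * a)) * (g (x + n * T - i * a) : ℂ)
          = if n = 0 then ((T⁻¹ : ℝ) : ℂ) else 0 := by
  have h0 : (0 : ℤ) ∈ Finset.Ioo (-m : ℤ) m := by
    rw [Finset.mem_Ioo]
    omega
  obtain ⟨C, hC⟩ := exists_bound_dualWindow hg ha hT hc hmc ⟨0, h0⟩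
  exact ⟨dualWindow a T g m ⟨0, h0⟩, C, measurable_dualWindow hg ha hT hc hmc _, hC,
    fun x hx => dualWindow_eq_zero_of_notMem_Icc _ ha hx,
    tsum_conj_dualWindow_mul hg ha hT hc hmc hmT _ rfl⟩

/-- A function supported in `[-(2m-1)a/2, (2m-1)a/2)` for which the sums of the duality conditions
vanish at the point `x` vanishes at `x`. -/
theorem eq_zero_of_tsum_conj_mul_eq_zero (hg : IsGeneralizedBSpline N a g) (ha : 0 < a)
    (hT : N / 2 < T) (hc : 0 < T - a) (hmc : ((m : ℝ) - 1) * (T - a) < (N - a) / 2)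
    {d : ℝ → ℂ}
    (hd : ∀ x, x ∉ Set.Ico (-((2 * (m : ℝ) - 1) / 2 * a)) ((2 * (m : ℝ) - 1) / 2 * a) → d x = 0)
    {x : ℝ} (hx : ∀ n : ℤ,
      ∑' i : ℤ, starRingEnd ℂ (d (x - i * a)) * (g (x + n * T - i * a) : ℂ) = 0) : d x = 0 := by
  obtain ⟨k, y, hy, rfl⟩ := exists_eq_add_int_mul ha x
  have hy' : |y| ≤ a / 2 := abs_le.2 ⟨hy.1, hy.2.le⟩
  have hd0 : ∀ j : ℤ, (m : ℤ) ≤ |j| → d (y + j * a) = 0 := fun j hj => by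
    refine hd _ fun h => ?_
    rcases le_abs.1 hj with h1 | h1
    · have h2 : (m : ℝ) ≤ j := by exact_mod_cast h1
      have h3 := mul_le_mul_of_nonneg_right h2 ha.le
      linarith [h.2, hy.1]
    · have h2 : (j : ℝ) ≤ -m := by exact_mod_cast (by omega : j ≤ -(m : ℤ))
      have h3 := mul_le_mul_of_nonneg_right h2 ha.le
      linarith [h.1, hy.2]
  have hd1 : ∀ j : ℤ, j ∉ Finset.Ioo (-m : ℤ) m → d (y + j * a) = 0 := fun j hj => by
    refine hd0 j (not_lt.1 fun h => hj ?_)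
    rwa [Finset.mem_Ioo, ← abs_lt]
  have hzero := eq_zero_of_sum_mul_eq_zero hg ha hT hc hmc hy'
    (v := fun j => starRingEnd ℂ (d (y + j * a))) (fun j hj => by rw [hd0 j hj, map_zero])
    (fun n _ => by
      have h := hx (-n)
      rw [tsum_conj_mul_eq_sum hd1] at h
      rw [← h]
      refine Finset.sum_congr rfl fun j _ => ?_
      push_cast
      rw [neg_mul, ← sub_eq_add_neg]) k
  exact (map_eq_zero _).1 hzero

end DualWindow

/-- The inequalities on `T = 1 / b` that define the parameter region, in the form used by the
duality conditions. -/
theorem inequalities_of_mem_gaborRegion {N a b : ℝ} (hN : 0 < N) {m : ℕ} (hm : 3 ≤ m)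
    (hab : (a, b) ∈ gaborRegion N m) :
    0 < a ∧ 0 < b ∧ N / 2 < 1 / b ∧ 0 < 1 / b - a ∧
      ((m : ℝ) - 1) * (1 / b - a) < (N - a) / 2 ∧
      N / 2 + (2 * (m : ℝ) - 1) / 2 * a ≤ m * (1 / b) := by
  obtain ⟨ha, hb, ⟨-, ha2⟩, ⟨hb1, hb2⟩, hb3⟩ := hab
  simp only at ha hb ha2 hb1 hb2 hb3
  have hm' : (3 : ℝ) ≤ m := by exact_mod_cast hm
  have hT : N / 2 < 1 / b := by
    rw [lt_div_iff₀ hb]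
    rw [lt_div_iff₀ hN] at hb3
    linarith
  refine ⟨ha, hb, hT, by linarith, ?_, ?_⟩
  · have hD : 0 < N + (2 * (m : ℝ) - 3) * a := by
      have := mul_pos (by linarith : (0 : ℝ) < 2 * m - 3) ha
      linarith
    rw [div_lt_iff₀ hD] at hb1
    have : ((m : ℝ) - 1) * (1 / b) < (N + (2 * (m : ℝ) - 3) * a) / 2 := by
      rw [mul_one_div, div_lt_iff₀ hb]
      linarith
    linarith
  · have hD : 0 < N + (2 * (m : ℝ) - 1) * a := by
      have := mul_pos (by linarith : (0 : ℝ) < 2 * m - 1) ha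
      linarith
    rw [le_div_iff₀ hD] at hb2
    rw [mul_one_div, le_div_iff₀ hb]
    linarith

theorem theorem1p2 (N a b : ℝ) (hN : 2 ≤ N) (g : ℝ → ℝ) (hg : IsGeneralizedBSpline N a g)
    (m : ℕ) (hm : 3 ≤ m) (hab : (a, b) ∈ gaborRegion N m) :
    IsGaborFrame hg.toL2 a b ∧
    ∃ h : L2R,
      IsGaborFrame h a b ∧
      IsDualWindow hg.toL2 h a b ∧
      IsEssBounded h ∧
      IsSupportedIn h (Set.Icc (-((2 * (m : ℝ) - 1) / 2 * a)) ((2 * (m : ℝ) - 1) / 2 * a)) ∧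
      ∀ h' : L2R,
        IsDualWindow hg.toL2 h' a b →
        IsSupportedIn h'
          (Set.Icc (-((2 * (m : ℝ) - 1) / 2 * a)) ((2 * (m : ℝ) - 1) / 2 * a)) →
        h' = h := by
  obtain ⟨ha, hb, hT, hc, hmc, hmT⟩ := inequalities_of_mem_gaborRegion (by linarith) hm hab
  have hm' : (3 : ℝ) ≤ m := by exact_mod_cast hm
  set r : ℝ := (2 * (m : ℝ) - 1) / 2 * a with hr
  have hr0 : 0 ≤ r := by
    have := mul_nonneg (by linarith : (0 : ℝ) ≤ (2 * (m : ℝ) - 1) / 2) ha.le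
    exact this
  have hG : hg.toL2 =ᵐ[volume] fun x => (g x : ℂ) := hg.memLp.coeFn_toLp
  have hgm : Measurable fun x => (g x : ℂ) :=
    (Complex.continuous_ofReal.comp hg.continuous).measurable
  obtain ⟨C₁, hC₁⟩ := hg.exists_bound
  obtain ⟨w, C₂, hwm, hC₂, hws, hdual⟩ :=
    exists_measurable_bounded_window hg ha hT hc hmc hmT (by omega)
  have hwR : ∀ x, N + r + 1 ≤ |x| → w x = 0 := fun x hx => hws x fun h => by
    have := abs_le.2 h
    linarith
  have hwL : MemLp w 2 volume := by
    refine memLp_of_bounded_of_support (c := -r - 1) (d := r) hwm hC₂ fun x hx => hws x fun h => ?_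
    exact hx ⟨by linarith [h.1], h.2⟩
  have hH := hwL.coeFn_toLp
  simp only [one_div, inv_inv, ← div_eq_mul_inv] at hdual
  obtain ⟨hfg, hfh, hD⟩ := isGaborFrame_of_duality (R := N + r + 1) (C := max C₁ C₂) ha hb hG hH
    hgm (fun x => (hC₁ x).trans (le_max_left _ _))
    (fun x hx => by rw [hg.eq_zero_of_le_abs (by linarith), Complex.ofReal_zero])
    hwm (fun x => (hC₂ x).trans (le_max_right _ _)) hwR hdual
  have hsupp : IsSupportedIn (hwL.toLp w) (Set.Icc (-r) r) := by
    filter_upwards [hH] with x hx hxr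
    rw [hx, hws x hxr]
  refine ⟨hfg, hwL.toLp w, hfh, hD, ⟨C₂, ?_⟩, hsupp, fun h' hD' hsupp' => ?_⟩
  · filter_upwards [hH] with x hx
    rw [hx]
    exact hC₂ x
  -- Discarding the null set `{r}` represents the difference by a function vanishing off `[-r, r)`.
  set d : ℝ → ℂ := (Set.Ico (-r) r).indicator (h' - hwL.toLp w : L2R) with hd
  have hdae : (h' - hwL.toLp w : L2R) =ᵐ[volume] d := by
    have hne : ∀ᵐ x : ℝ, x ≠ r := by simp [ae_iff]
    filter_upwards [hsupp, hsupp', Lp.coeFn_sub h' (hwL.toLp w), hne] with x h1 h2 h3 h4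
    by_cases hx : x ∈ Set.Ico (-r) r
    · rw [hd, Set.indicator_of_mem hx]
    · have hx' : x ∉ Set.Icc (-r) r := fun h => hx ⟨h.1, lt_of_le_of_ne h.2 h4⟩
      rw [hd, Set.indicator_of_notMem hx, h3, Pi.sub_apply, h1 hx', h2 hx', sub_zero]
  have hds : ∀ x, x ∉ Set.Ico (-r) r → d x = 0 := fun x hx => Set.indicator_of_notMem hx _
  have hdL : MemLp d 2 volume := (memLp_congr_ae hdae).1 (Lp.memLp _)
  have hz := ae_tsum_conj_mul_eq_zero (R := r + 1) ha hb hgm hC₁ hdL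
    (fun x hx => hds x fun h => by
      have := abs_le.2 ⟨h.1, h.2.le⟩
      linarith)
    (fun f f' hf hf' => hasSum_conj_gaborCoeff_sub_mul_eq_zero hG hdae hD hD' hf hf')
  rw [← sub_eq_zero, Lp.eq_zero_iff_ae_eq_zero]
  filter_upwards [hz, hdae] with x hx hx'
  rw [hx', Pi.zero_apply]
  refine eq_zero_of_tsum_conj_mul_eq_zero hg ha hT hc hmc hds fun n => ?_
  simpa only [mul_one_div] using hx n
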